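/- Let $\Sigma$ be a smooth surface, possibly with boundary, let $\mathbf r:\Sigma\to\mathbb R^3$ be a smooth immersion with a smooth unit normal field $\mathbf n$, and give $\Sigma$ the induced metric $g$, with Levi-Civita connection $\nabla$. Let $h(v,w)=-\langle D_v\mathbf n,w\rangle$ be the second fundamental form, $S$ the shape operator, determined by $g(Sv,w)=h(v,w)$, $H=\operatorname{tr}S$ the mean curvature (the sum of the principal curvatures) and $K=\det S$ the Gaussian curvature. Let $F$ be a smooth real function of two variables on an open subset of $\mathbb R^2$ that contains all values $(H(p),K(p))$, $p\in\Sigma$; write $F,F_H,F_K$ for the functions $F(H,K)$, $\partial_1F(H,K)$, $\partial_2F(H,K)$ on $\Sigma$. Put $$W=\Delta F_H+H\Delta F_K-\langle h,\mathrm{Hess}\,F_K\rangle+F_H|h|^2+HKF_K-HF,$$ $$T=F_KS^2-(F_H+HF_K)S+\big(S(\nabla F_K)-\nabla F_H-H\nabla F_K\big)\otimes\mathbf n+F\,\nabla\mathbf r.$$ Here $T$ is regarded as a field of linear maps $T_p:\mathbb R^3\to T_p\Sigma$, where $S(e)$ means $S(e^\top)$ with $e^\top$ the tangential part of $e\in\mathbb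 R^3$, $(Z\otimes\mathbf n)(e)=\langle\mathbf n,e\rangle Z$, and $(\nabla\mathbf r)(e)=e^\top$; its divergence $\mathrm{div}_g T$ is the $\mathbb R^3$-valued function determined by $\langle e,\mathrm{div}_gT\rangle=\mathrm{div}_g(Te)$ for every constant vector $e\in\mathbb R^3$. The surface is called a $\mathcal W$-surface (stationary for $\mathcal W=\int_\Sigma F(H,K)\,d\mu$) if it satisfies the Euler–Lagrange equation $W=0$ on $\Sigma$. Then $$\mathrm{div}_g\,T=-W\,\mathbf n\quad\text{on }\Sigma .$$ In particular, $\Sigma$ is a $\mathcal W$-surface if and only if $\mathrm{div}_g\,T=0$ on $\Sigma$. -/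

import Mathlib

open scoped Manifold ContDiff

noncomputable section

namespace ImmersedSurface

/-- The Euclidean plane, on which the surface is modelled. -/
abbrev E2 : Type := EuclideanSpace ℝ (Fin 2)

/-- The ambient Euclidean space `ℝ³`. -/
abbrev E3 : Type := EuclideanSpace ℝ (Fin 3)

variable {H₀ : Type*} [TopologicalSpace H₀] (I : ModelWithCorners ℝ E2 H₀)
  {M : Type*} [TopologicalSpace M] [ChartedSpace H₀ M]

/-! ### The class of immersed surfaces -/

/-- `r` is a smooth immersion of the surface `M` (possibly with boundary) into `ℝ³` and `n` is a
smooth unit normal field along it. The surface carries the metric induced by `r`, and it is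
oriented by `n`. -/
structure IsImmersionWithNormal (r n : M → E3) : Prop where
  smooth_immersion : ContMDiff I 𝓘(ℝ, E3) ∞ r
  injective_deriv : ∀ p : M, Function.Injective (mvfderiv I r p)
  smooth_normal : ContMDiff I 𝓘(ℝ, E3) ∞ n
  norm_normal : ∀ p : M, ‖n p‖ = 1
  orthogonal_normal : ∀ (p : M) (v : TangentSpace I p), inner ℝ (mvfderiv I r p v) (n p) = 0

/-! ### Pointwise linear algebra on the tangent planes -/

/-- The coordinate basis `∂₁, ∂₂` of `T_pM` given by the preferred chart at `p` (the tangent space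
at `p` is identified with the model space through this chart). -/
def tangentBasis (p : M) : Module.Basis (Fin 2) ℝ (TangentSpace I p) :=
  (EuclideanSpace.basisFun (Fin 2) ℝ).toBasis

/-- The induced metric `g(v, w) = ⟨dr(v), dr(w)⟩`. -/
def metric (r : M → E3) (p : M) : TangentSpace I p →ₗ[ℝ] TangentSpace I p →ₗ[ℝ] ℝ :=
  (innerₗ E3).compl₁₂ (mvfderiv I r p : TangentSpace I p →ₗ[ℝ] E3)
    (mvfderiv I r p : TangentSpace I p →ₗ[ℝ] E3)

/-- The inverse metric matrix `g^{ij}` at `p`. -/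
def invGram (r : M → E3) (p : M) : Matrix (Fin 2) (Fin 2) ℝ :=
  (Matrix.of fun i j => metric I r p (tangentBasis I p i) (tangentBasis I p j))⁻¹

/-- The musical isomorphism `♯ : T_p^*M → T_pM`, that is `α ↦ ∑ g^{ij} α(∂_j) ∂_i`; the vector
`♯α` is determined by `g(♯α, w) = α(w)`. -/
def sharp (r : M → E3) (p : M) :
    Module.Dual ℝ (TangentSpace I p) →ₗ[ℝ] TangentSpace I p :=
  Matrix.toLin (tangentBasis I p).dualBasis (tangentBasis I p) (invGram I r p)

/-- The second fundamental form `h(v, w) = -⟨D_v n, w⟩`. -/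
def secondForm (r n : M → E3) (p : M) :
    TangentSpace I p →ₗ[ℝ] TangentSpace I p →ₗ[ℝ] ℝ :=
  -(innerₗ E3).compl₁₂ (mvfderiv I n p : TangentSpace I p →ₗ[ℝ] E3)
    (mvfderiv I r p : TangentSpace I p →ₗ[ℝ] E3)

/-- The shape operator `S`, determined by `g(S v, w) = h(v, w)`. -/
def shape (r n : M → E3) (p : M) : TangentSpace I p →ₗ[ℝ] TangentSpace I p :=
  sharp I r p ∘ₗ secondForm I r n p

/-- The mean curvature `H = tr_g h = κ₁ + κ₂`. -/
def meanCurv (r n : M → E3) (p : M) : ℝ := LinearMap.trace ℝ _ (shape I r n p)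

/-- The Gaussian curvature `K = det h / det g = κ₁ κ₂`. -/
def gaussCurv (r n : M → E3) (p : M) : ℝ := LinearMap.det (shape I r n p)

/-- The inner product `⟨A, B⟩ = g^{ik} g^{jl} A_{ij} B_{kl}` of bilinear forms on `T_pM`. -/
def formInner (r : M → E3) (p : M)
    (A B : TangentSpace I p →ₗ[ℝ] TangentSpace I p →ₗ[ℝ] ℝ) : ℝ :=
  ∑ i, ∑ j, ∑ k, ∑ l, invGram I r p i k * invGram I r p j l *
    A (tangentBasis I p i) (tangentBasis I p j) * B (tangentBasis I p k) (tangentBasis I p l)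

/-- The tangential part `e^⊤ ∈ T_pM` of a vector `e` of `ℝ³`: `g(e^⊤, w) = ⟨e, dr(w)⟩`. -/
def tangentialPart (r : M → E3) (p : M) : E3 →ₗ[ℝ] TangentSpace I p :=
  sharp I r p ∘ₗ (innerₗ E3).compl₁₂ LinearMap.id (mvfderiv I r p : TangentSpace I p →ₗ[ℝ] E3)

/-! ### The Levi-Civita connection and its differential operators

The connection is given by the Christoffel symbols of the induced metric in the preferred chart
`φ` at `p`. Derivatives are taken within the range of the model, as usual for manifolds with
boundary. -/

/-- The partial derivative `∂_i f` on the coordinate domain. -/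
def coordDeriv {V : Type*} [NormedAddCommGroup V] [NormedSpace ℝ V]
    (f : E2 → V) (i : Fin 2) (x : E2) : V :=
  fderivWithin ℝ f (Set.range I) x (EuclideanSpace.single i 1)

/-- The components `g_{ij} = ⟨∂_i(r ∘ φ⁻¹), ∂_j(r ∘ φ⁻¹)⟩` of the metric in the chart `φ` at `p`. -/
def chartMetric (r : M → E3) (p : M) (i j : Fin 2) (x : E2) : ℝ :=
  inner ℝ (coordDeriv I (r ∘ (extChartAt I p).symm) i x)
    (coordDeriv I (r ∘ (extChartAt I p).symm) j x)

/-- The Christoffel symbols `Γ^k_{ij} = ½ g^{kl} (∂_i g_{jl} + ∂_j g_{il} - ∂_l g_{ij})` in the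
chart `φ` at `p`. -/
def christoffel (r : M → E3) (p : M) (k i j : Fin 2) (x : E2) : ℝ :=
  (1 / 2) * ∑ l, (Matrix.of fun a b => chartMetric I r p a b x)⁻¹ k l *
    (coordDeriv I (chartMetric I r p j l) i x + coordDeriv I (chartMetric I r p i l) j x
      - coordDeriv I (chartMetric I r p i j) l x)

/-- The components `X^k` of a vector field in the chart `φ` at `p`: the `k`-th coordinate of
`dφ(X)`, as a function on the coordinate domain. -/
def chartField (X : Π q : M, TangentSpace I q) (p : M) (k : Fin 2) (x : E2) : ℝ :=
  (mvfderiv I (extChartAt I p) ((extChartAt I p).symm x) (X ((extChartAt I p).symm x))) k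

/-- The covariant derivative `v ↦ ∇_v X` at `p` for the Levi-Civita connection of the induced
metric: `(∇_{∂_i} X)^k = ∂_i X^k + Γ^k_{ij} X^j`. -/
def covDeriv (r : M → E3) (X : Π q : M, TangentSpace I q) (p : M) :
    TangentSpace I p →ₗ[ℝ] TangentSpace I p :=
  Matrix.toLin (tangentBasis I p) (tangentBasis I p) (Matrix.of fun k i =>
    coordDeriv I (chartField I X p k) i (extChartAt I p p) +
      ∑ j, christoffel I r p k i j (extChartAt I p p) * chartField I X p j (extChartAt I p p))

/-- The divergence `div_g X = tr (v ↦ ∇_v X)`. -/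
def divergence (r : M → E3) (X : Π q : M, TangentSpace I q) (p : M) : ℝ :=
  LinearMap.trace ℝ _ (covDeriv I r X p)

/-- The gradient `∇f = ♯(df)`. -/
def grad (r : M → E3) (f : M → ℝ) (p : M) : TangentSpace I p :=
  sharp I r p (mvfderiv I f p : TangentSpace I p →ₗ[ℝ] ℝ)

/-- The Hessian `Hess f (v, w) = g(∇_v ∇f, w)`. -/
def hess (r : M → E3) (f : M → ℝ) (p : M) :
    TangentSpace I p →ₗ[ℝ] TangentSpace I p →ₗ[ℝ] ℝ :=
  metric I r p ∘ₗ covDeriv I r (grad I r f) p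

/-- The Laplace-Beltrami operator `Δf = div_g ∇f`. -/
def laplacian (r : M → E3) (f : M → ℝ) (p : M) : ℝ := divergence I r (grad I r f) p

/-- The divergence of a tensor field `T : ℝ³ → T_pM`, the vector of `ℝ³` determined by
`⟨e, div_g T⟩ = div_g (T e)` for constant `e`. -/
def tensorDiv (r : M → E3) (T : Π q : M, E3 →ₗ[ℝ] TangentSpace I q) (p : M) : E3 :=
  ∑ a : Fin 3, divergence I r (fun q => T q (EuclideanSpace.single a 1)) p •
    EuclideanSpace.single a (1 : ℝ)

/-! ### The curvature functional -/

/-- The Lagrangian `F(H, K)` along the surface. -/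
def lagr (r n : M → E3) (F : ℝ × ℝ → ℝ) (p : M) : ℝ :=
  F (meanCurv I r n p, gaussCurv I r n p)

/-- `F_H` along the surface: the partial derivative in the first variable at `(H, K)`. -/
def lagrH (r n : M → E3) (F : ℝ × ℝ → ℝ) (p : M) : ℝ :=
  deriv (fun t => F (t, gaussCurv I r n p)) (meanCurv I r n p)

/-- `F_K` along the surface: the partial derivative in the second variable at `(H, K)`. -/
def lagrK (r n : M → E3) (F : ℝ × ℝ → ℝ) (p : M) : ℝ :=
  deriv (fun t => F (meanCurv I r n p, t)) (gaussCurv I r n p)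

/-- The Euler-Lagrange expression
`W = Δ F_H + H Δ F_K - ⟨h, Hess F_K⟩ + F_H |h|² + H K F_K - H F`. -/
def eulerLagrange (r n : M → E3) (F : ℝ × ℝ → ℝ) (p : M) : ℝ :=
  laplacian I r (lagrH I r n F) p + meanCurv I r n p * laplacian I r (lagrK I r n F) p
    - formInner I r p (secondForm I r n p) (hess I r (lagrK I r n F) p)
    + lagrH I r n F p * formInner I r p (secondForm I r n p) (secondForm I r n p)
    + meanCurv I r n p * gaussCurv I r n p * lagrK I r n F p
    - meanCurv I r n p * lagr I r n F p

/-- The surface is stationary for `∫ F(H, K) dμ`: it satisfies the Euler-Lagrange equation. -/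
def IsWSurface (r n : M → E3) (F : ℝ × ℝ → ℝ) : Prop :=
  ∀ p : M, eulerLagrange I r n F p = 0

/-- The stress tensor
`T = F_K S² - (F_H + H F_K) S + (S(∇F_K) - ∇F_H - H ∇F_K) ⊗ n + F ∇r`, as a linear map
`ℝ³ → T_pM`. Here `S e` means `S (e^⊤)`, `(Z ⊗ n) e = ⟨n, e⟩ Z`, and `∇r` is the map `e ↦ e^⊤`,
since `∇_v r = v` for tangent vectors `v`. -/
def stress (r n : M → E3) (F : ℝ × ℝ → ℝ) (p : M) : E3 →ₗ[ℝ] TangentSpace I p :=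
  lagrK I r n F p • (shape I r n p ∘ₗ shape I r n p ∘ₗ tangentialPart I r p)
    - (lagrH I r n F p + meanCurv I r n p * lagrK I r n F p) •
        (shape I r n p ∘ₗ tangentialPart I r p)
    + (innerₗ E3 (n p)).smulRight
        (shape I r n p (grad I r (lagrK I r n F) p) - grad I r (lagrH I r n F) p
          - meanCurv I r n p • grad I r (lagrK I r n F) p)
    + lagr I r n F p • tangentialPart I r p

end ImmersedSurface

end

noncomputable section

namespace ImmersedSurface

section

variable {H₀ : Type*} [TopologicalSpace H₀] {I : ModelWithCorners ℝ E2 H₀}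
  {M : Type*} [TopologicalSpace M] [ChartedSpace H₀ M]
  {E F G : Type*} [NormedAddCommGroup E] [NormedSpace ℝ E] [NormedAddCommGroup F]
  [NormedSpace ℝ F] [NormedAddCommGroup G] [NormedSpace ℝ G]

/-! The computation is moved from the tangent planes to `ℝ³`. A function `f` on the surface has the
tangential derivative `tderiv f : e ↦ df(e^⊤)`, a linear map on the fixed space `ℝ³`, and a tangent
field `X` is replaced by the vector-valued function `dr(X)`. The Gauss formula (`covDeriv_eq`) says
that `∇_v X` is the tangential part of the derivative of `dr(X)`, so `div_g X` is the trace of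
`tderiv (dr X)` (`divergence_eq`). The shape operator becomes `A = -tderiv n`, extended by `A n =
0`, with `H = tr A` and `2K = H² - tr A²`.

Second tangential derivatives do not commute, but their defect is determined by that of `r`
(`tderiv_commutator`). For `f = r` this gives the symmetry of `A`, for `f = n` the Codazzi equation,
whose trace is `div A = dH + |h|² n` (`tr_flip_tderiv_ambientShape`).

By Cayley-Hamilton, `A² = HA - K` on tangent vectors, so that `T e = (F - K F_K) e^⊤ - F_H A e + ⟨n,
e⟩ Z` with `Z = A∇F_K - ∇F_H - H∇F_K`. The product rule then leaves: `div((F - K F_K) e^⊤) = F_H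
dH(e) - K dF_K(e) + (F - K F_K) H ⟨n, e⟩`; `div(F_H A e) = dF_H(A e) + F_H (dH(e) + |h|² ⟨n, e⟩)`;
`div(⟨n, e⟩ Z) = -⟨Z, A e⟩ + ⟨n, e⟩ div Z`, where `-⟨Z, A e⟩ = K dF_K(e) + dF_H(A e)` by
Cayley-Hamilton again. The terms without `⟨n, e⟩` cancel and the coefficient of `⟨n, e⟩` is `-W`.
Since `n` never vanishes, the equivalence follows. -/

instance finiteDimensional_tangentSpace (p : M) : FiniteDimensional ℝ (TangentSpace I p) :=
  (tangentBasis I p).finiteDimensional_of_finite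

theorem finrank_tangentSpace (p : M) : Module.finrank ℝ (TangentSpace I p) = 2 := by
  rw [Module.finrank_eq_card_basis (tangentBasis I p), Fintype.card_fin]

/-! ### Differentiation of vector valued functions on the surface -/

theorem mvfderiv_eq_fderivWithin {f : M → E} {p : M} (hf : MDifferentiableAt I 𝓘(ℝ, E) f p) :
    mvfderiv I f p =
      fderivWithin ℝ (f ∘ (extChartAt I p).symm) (Set.range I) (extChartAt I p p) :=
  hf.mvfderiv

theorem uniqueDiffWithinAt_range (p : M) :
    UniqueDiffWithinAt ℝ (Set.range I) (extChartAt I p p) :=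
  I.uniqueDiffOn.uniqueDiffWithinAt (Set.mem_range_self _)

theorem differentiableWithinAt_chart {f : M → E} {p : M}
    (hf : MDifferentiableAt I 𝓘(ℝ, E) f p) :
    DifferentiableWithinAt ℝ (f ∘ (extChartAt I p).symm) (Set.range I) (extChartAt I p p) := by
  exact ((mdifferentiableAt_iff f p).1 hf).2

theorem mdifferentiableAt_iff_chart {f : M → E} {p : M} :
    MDifferentiableAt I 𝓘(ℝ, E) f p ↔ ContinuousAt f p ∧
      DifferentiableWithinAt ℝ (f ∘ (extChartAt I p).symm) (Set.range I) (extChartAt I p p) := by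
  exact mdifferentiableAt_iff f p

theorem mdifferentiableAt_bilin (B : E →L[ℝ] F →L[ℝ] G) {f : M → E} {g : M → F} {p : M}
    (hf : MDifferentiableAt I 𝓘(ℝ, E) f p) (hg : MDifferentiableAt I 𝓘(ℝ, F) g p) :
    MDifferentiableAt I 𝓘(ℝ, G) (fun q => B (f q) (g q)) p := by
  rw [mdifferentiableAt_iff_chart] at *
  refine ⟨(B.isBoundedBilinearMap.continuous.continuousAt).comp (hf.1.prodMk hg.1), ?_⟩
  exact B.isBoundedBilinearMap.differentiableAt _ |>.comp_differentiableWithinAt _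
    (hf.2.prodMk hg.2)

theorem mvfderiv_bilin (B : E →L[ℝ] F →L[ℝ] G) {f : M → E} {g : M → F} {p : M}
    (hf : MDifferentiableAt I 𝓘(ℝ, E) f p) (hg : MDifferentiableAt I 𝓘(ℝ, F) g p)
    (v : TangentSpace I p) :
    mvfderiv I (fun q => B (f q) (g q)) p v =
      B (mvfderiv I f p v) (g p) + B (f p) (mvfderiv I g p v) := by
  rw [mvfderiv_eq_fderivWithin (mdifferentiableAt_bilin B hf hg), mvfderiv_eq_fderivWithin hf,
    mvfderiv_eq_fderivWithin hg]
  have := B.fderivWithin_of_bilinear (differentiableWithinAt_chart hf)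
    (differentiableWithinAt_chart hg) (uniqueDiffWithinAt_range p)
  simp only [Function.comp_apply, extChartAt_to_inv] at this
  rw [add_comm]
  exact congrArg (fun L => L v) this

theorem mdifferentiableAt_comp {g : E → F} {f : M → E} {p : M} (hg : DifferentiableAt ℝ g (f p))
    (hf : MDifferentiableAt I 𝓘(ℝ, E) f p) :
    MDifferentiableAt I 𝓘(ℝ, F) (fun q => g (f q)) p :=
  hg.comp_mdifferentiableAt hf

theorem mvfderiv_comp_fderiv {g : E → F} {f : M → E} {p : M} (hg : DifferentiableAt ℝ g (f p))
    (hf : MDifferentiableAt I 𝓘(ℝ, E) f p) (v : TangentSpace I p) :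
    mvfderiv I (fun q => g (f q)) p v = fderiv ℝ g (f p) (mvfderiv I f p v) := by
  rw [mvfderiv_eq_fderivWithin (mdifferentiableAt_comp hg hf), mvfderiv_eq_fderivWithin hf]
  have hg' : DifferentiableAt ℝ g ((f ∘ (extChartAt I p).symm) (extChartAt I p p)) := by
    simpa using hg
  have := fderiv_comp_fderivWithin _ hg' (differentiableWithinAt_chart hf)
    (uniqueDiffWithinAt_range p)
  simp only [Function.comp_apply, extChartAt_to_inv] at this
  exact congrArg (fun L => L v) this

theorem smooth_bilin (B : E →L[ℝ] F →L[ℝ] G) {f : M → E} {g : M → F}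
    (hf : ContMDiff I 𝓘(ℝ, E) ∞ f) (hg : ContMDiff I 𝓘(ℝ, F) ∞ g) :
    ContMDiff I 𝓘(ℝ, G) ∞ (fun q => B (f q) (g q)) :=
  B.isBoundedBilinearMap.contDiff.comp_contMDiff (hf.prodMk_space hg)

theorem smooth_clm (B : E →L[ℝ] F) {f : M → E} (hf : ContMDiff I 𝓘(ℝ, E) ∞ f) :
    ContMDiff I 𝓘(ℝ, F) ∞ (fun q => B (f q)) :=
  B.contDiff.comp_contMDiff hf

/-! ### Linear algebra on the tangent planes -/

section Pointwise

variable {r n : M → E3}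

theorem metric_apply (p : M) (v w : TangentSpace I p) :
    metric I r p v w = inner ℝ (mvfderiv I r p v) (mvfderiv I r p w) := rfl

namespace IsImmersionWithNormal

variable (hrn : IsImmersionWithNormal I r n)
include hrn

theorem mdiff_immersion (p : M) : MDifferentiableAt I 𝓘(ℝ, E3) r p :=
  hrn.smooth_immersion.mdifferentiable (by simp) p

theorem mdiff_normal (p : M) : MDifferentiableAt I 𝓘(ℝ, E3) n p :=
  hrn.smooth_normal.mdifferentiable (by simp) p

theorem isUnit_det_gram (p : M) : IsUnit (Matrix.of fun i j =>
    metric I r p (tangentBasis I p i) (tangentBasis I p j)).det := by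
  have h : LinearIndependent ℝ (fun i => mvfderiv I r p (tangentBasis I p i)) :=
    (tangentBasis I p).linearIndependent.map' (mvfderiv I r p : TangentSpace I p →ₗ[ℝ] E3)
      (LinearMap.ker_eq_bot.2 (hrn.injective_deriv p))
  exact (Matrix.posDef_gram_of_linearIndependent h).det_pos.ne'.isUnit

theorem metric_sharp (p : M) (α : Module.Dual ℝ (TangentSpace I p)) (w : TangentSpace I p) :
    metric I r p w (sharp I r p α) = α w := by
  suffices h : (metric I r p).flip (sharp I r p α) = α from congrArg (fun L => L w) h
  refine (tangentBasis I p).ext fun i => ?_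
  -- The defining property of `♯` is `G G⁻¹ = 1` applied to the coordinate vector of `α`.
  have h := Matrix.mul_nonsing_inv _ (hrn.isUnit_det_gram p)
  have h2 := congrArg (fun A => (A.mulVec fun k => α (tangentBasis I p k)) i) h
  simp only [← Matrix.mulVec_mulVec, Matrix.one_mulVec] at h2
  rw [← h2, sharp, Matrix.toLin_apply]
  simp only [Matrix.mulVec, dotProduct, map_sum, map_smul, smul_eq_mul, invGram, Matrix.of_apply,
    LinearMap.sum_apply, LinearMap.smul_apply, LinearMap.flip_apply, Module.Basis.dualBasis_repr]
  exact Finset.sum_congr rfl fun j _ => mul_comm (_ : ℝ) _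

theorem inner_tangentialPart (p : M) (e : E3) (w : TangentSpace I p) :
    inner ℝ (mvfderiv I r p w) (mvfderiv I r p (tangentialPart I r p e)) =
      inner ℝ e (mvfderiv I r p w) :=
  hrn.metric_sharp p _ w

theorem inner_shape (p : M) (v w : TangentSpace I p) :
    inner ℝ (mvfderiv I r p w) (mvfderiv I r p (shape I r n p v)) =
      -inner ℝ (mvfderiv I n p v) (mvfderiv I r p w) :=
  hrn.metric_sharp p _ w

/-- The map `(v, t) ↦ dr(v) + t n` is injective between spaces of dimension three, hence onto.
Vector identities in `ℝ³` can therefore be tested against tangent vectors and `n`. -/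
theorem eq_zero_of_orthogonal (p : M) {u : E3} (h : ∀ w, inner ℝ (mvfderiv I r p w) u = 0)
    (hn : inner ℝ (n p) u = 0) : u = 0 := by
  let Φ : (TangentSpace I p × ℝ) →ₗ[ℝ] E3 :=
    (mvfderiv I r p : TangentSpace I p →ₗ[ℝ] E3).coprod (LinearMap.toSpanSingleton ℝ E3 (n p))
  have hΦ (v t) : Φ (v, t) = mvfderiv I r p v + t • n p := rfl
  have hnn : inner ℝ (n p) (n p) = (1 : ℝ) := by
    rw [real_inner_self_eq_norm_sq, hrn.norm_normal]; norm_num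
  have hinj : Function.Injective Φ := by
    rw [injective_iff_map_eq_zero]
    rintro ⟨v, t⟩ hv
    rw [hΦ] at hv
    have ht : t = 0 := by
      have := congrArg (fun z => inner ℝ z (n p)) hv
      simpa only [inner_add_left, hrn.orthogonal_normal, real_inner_smul_left, hnn, zero_add, mul_one,
        inner_zero_left] using this
    subst ht
    have : v = 0 := hrn.injective_deriv p (by simpa using hv)
    simp [this]
  have hsurj : Function.Surjective Φ :=
    (LinearMap.injective_iff_surjective_of_finrank_eq_finrank
      (by simp [finrank_tangentSpace])).1 hinj
  obtain ⟨⟨v, t⟩, hv⟩ := hsurj u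
  rw [← inner_self_eq_zero (𝕜 := ℝ)]
  nth_rewrite 1 [← hv]
  rw [hΦ, inner_add_left, inner_smul_left, h, hn]
  simp

theorem inner_normal_self (p : M) : inner ℝ (n p) (n p) = (1 : ℝ) := by
  rw [real_inner_self_eq_norm_sq, hrn.norm_normal]; norm_num

theorem mvfderiv_tangentialPart (p : M) (e : E3) :
    mvfderiv I r p (tangentialPart I r p e) = e - inner ℝ (n p) e • n p := by
  rw [← sub_eq_zero]
  have hn := hrn.inner_normal_self p
  have ho := hrn.orthogonal_normal p
  refine hrn.eq_zero_of_orthogonal p (fun w => ?_) ?_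
  · rw [inner_sub_right, hrn.inner_tangentialPart, inner_sub_right, inner_smul_right, ho,
      real_inner_comm]
    simp
  · rw [inner_sub_right, real_inner_comm, ho, inner_sub_right, inner_smul_right, hn]
    simp

theorem tangentialPart_mvfderiv (p : M) (v : TangentSpace I p) :
    tangentialPart I r p (mvfderiv I r p v) = v := by
  apply hrn.injective_deriv p
  rw [hrn.mvfderiv_tangentialPart, real_inner_comm, hrn.orthogonal_normal]
  simp

theorem tangentialPart_normal (p : M) : tangentialPart I r p (n p) = 0 := by
  apply hrn.injective_deriv p
  rw [hrn.mvfderiv_tangentialPart, hrn.inner_normal_self]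
  simp

/-- Differentiate `⟨n, n⟩ = 1`. -/
theorem inner_mvfderiv_normal (p : M) (v : TangentSpace I p) :
    inner ℝ (n p) (mvfderiv I n p v) = 0 := by
  have h := mvfderiv_bilin (innerSL ℝ) (hrn.mdiff_normal p) (hrn.mdiff_normal p) v
  have h1 : (fun q => innerSL ℝ (n q) (n q)) = fun _ : M => (1 : ℝ) :=
    funext fun q => hrn.inner_normal_self q
  rw [h1, mvfderiv_const] at h
  change (0 : ℝ) = inner ℝ (mvfderiv I n p v) (n p) + inner ℝ (n p) (mvfderiv I n p v) at h
  rw [real_inner_comm] at h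
  linarith

theorem mvfderiv_shape (p : M) (v : TangentSpace I p) :
    mvfderiv I r p (shape I r n p v) = -mvfderiv I n p v := by
  rw [← sub_eq_zero]
  refine hrn.eq_zero_of_orthogonal p (fun w => ?_) ?_
  · rw [inner_sub_right, hrn.inner_shape, inner_neg_right, real_inner_comm]
    simp
  · rw [inner_sub_right, real_inner_comm, hrn.orthogonal_normal, inner_neg_right,
      hrn.inner_mvfderiv_normal]
    simp

end IsImmersionWithNormal
end Pointwise

end

section

variable {H₀ : Type*} [TopologicalSpace H₀] {I : ModelWithCorners ℝ E2 H₀}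
  {M : Type*} [TopologicalSpace M] [ChartedSpace H₀ M]
  {E F G : Type*} [NormedAddCommGroup E] [NormedSpace ℝ E] [NormedAddCommGroup F]
  [NormedSpace ℝ F] [NormedAddCommGroup G] [NormedSpace ℝ G]

/-! ### The tangential derivative -/

/-- The tangential derivative `e ↦ df(e^⊤)` of a function along the surface, as a linear map on
the ambient space. -/
def tderiv (I : ModelWithCorners ℝ E2 H₀) (r : M → E3) (f : M → E) (p : M) : E3 →L[ℝ] E :=
  LinearMap.toContinuousLinearMap
    ((mvfderiv I f p : TangentSpace I p →ₗ[ℝ] E) ∘ₗ tangentialPart I r p)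

theorem tderiv_apply (r : M → E3) (f : M → E) (p : M) (e : E3) :
    tderiv I r f p e = mvfderiv I f p (tangentialPart I r p e) := rfl

/-! ### Reading derivatives in a fixed chart, boundary points included. -/

section Chart

theorem two_le_infty : (2 : WithTop ℕ∞) ≤ ∞ :=
  WithTop.coe_le_coe.2 (le_top : (2 : ℕ∞) ≤ ⊤)

theorem smooth_chart {f : M → E} {p : M} (hf : ContMDiffAt I 𝓘(ℝ, E) ∞ f p) :
    ContDiffWithinAt ℝ ∞ (f ∘ (extChartAt I p).symm) (Set.range I) (extChartAt I p p) :=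
  (contMDiffAt_iff.1 hf).2

theorem smooth_fderivWithin_chart {f : M → E} (hf : ContMDiff I 𝓘(ℝ, E) ∞ f) (p : M) :
    ContDiffWithinAt ℝ ∞ (fderivWithin ℝ (f ∘ (extChartAt I p).symm) (Set.range I))
      (Set.range I) (extChartAt I p p) :=
  (smooth_chart (hf p)).fderivWithin_right I.uniqueDiffOn (by simp) (Set.mem_range_self _)

/-- At a boundary point symmetry persists because the range of the model lies in the closure of its
interior. -/
theorem isSymm_chart {f : M → E} (hf : ContMDiff I 𝓘(ℝ, E) ∞ f) (p : M) :
    IsSymmSndFDerivWithinAt ℝ (f ∘ (extChartAt I p).symm) (Set.range I) (extChartAt I p p) :=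
  (smooth_chart (hf p)).isSymmSndFDerivWithinAt (by simpa using two_le_infty) I.uniqueDiffOn
    (I.range_subset_closure_interior (Set.mem_range_self _)) (Set.mem_range_self _)

theorem isManifold_one (I : ModelWithCorners ℝ E2 H₀) (M : Type*) [TopologicalSpace M]
    [ChartedSpace H₀ M] [IsManifold I ∞ M] : IsManifold I 1 M :=
  IsManifold.of_le (n := ∞) (by exact_mod_cast le_top)

variable [IsManifold I ∞ M]

/-- The tangent space at `q` is identified with the plane through the preferred chart at `q`.
Working in the chart at `p` for all nearby `q` costs the transition factor on the right. -/
theorem mvfderiv_eq_extChartAt {f : M → E} {p q : M} (hq : q ∈ (extChartAt I p).source)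
    (hf : MDifferentiableAt I 𝓘(ℝ, E) f q) (v : TangentSpace I q) :
    mvfderiv I f q v =
      fderivWithin ℝ (f ∘ (extChartAt I p).symm) (Set.range I) (extChartAt I p q)
        (mvfderiv I (extChartAt I p) q v) := by
  have := isManifold_one I M
  have hφ : MDifferentiableAt I 𝓘(ℝ, E2) (extChartAt I p) q :=
    mdifferentiableAt_extChartAt (by rwa [extChartAt_source] at hq)
  have h1 : MDifferentiableWithinAt 𝓘(ℝ, E2) 𝓘(ℝ, E) (f ∘ (extChartAt I p).symm)
      (Set.range I) (extChartAt I p q) :=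
    MDifferentiableAt.comp_mdifferentiableWithinAt (extChartAt I p q)
      (by rwa [(extChartAt I p).left_inv hq])
      (mdifferentiableWithinAt_extChartAt_symm ((extChartAt I p).map_source hq))
  have h2 := HasMFDerivWithinAt.comp (s := Set.univ) q h1.hasMFDerivWithinAt
    hφ.hasMFDerivAt.hasMFDerivWithinAt (fun z _ => Set.mem_range_self _)
  rw [hasMFDerivWithinAt_univ] at h2
  have h3 : f =ᶠ[nhds q] (f ∘ (extChartAt I p).symm) ∘ extChartAt I p := by
    filter_upwards [extChartAt_source_mem_nhds' hq] with z hz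
    simp only [Function.comp_apply]
    rw [(extChartAt I p).left_inv hz]
  have h4 := (h2.congr_of_eventuallyEq h3).mfderiv
  rw [mfderivWithin_eq_fderivWithin] at h4
  exact congrArg (fun L => L v) h4

theorem mvfderiv_chart {f : M → E} {p : M} {x : E2} (hx : x ∈ (extChartAt I p).target)
    (hf : MDifferentiableAt I 𝓘(ℝ, E) f ((extChartAt I p).symm x))
    (v : TangentSpace I ((extChartAt I p).symm x)) :
    mvfderiv I f ((extChartAt I p).symm x) v =
      fderivWithin ℝ (f ∘ (extChartAt I p).symm) (Set.range I) x
        (mvfderiv I (extChartAt I p) ((extChartAt I p).symm x) v) := by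
  rw [mvfderiv_eq_extChartAt ((extChartAt I p).map_target hx) hf, (extChartAt I p).right_inv hx]

theorem mvfderiv_extChartAt_self (p : M) (v : TangentSpace I p) :
    mvfderiv I (extChartAt I p) p v = v := by
  have := isManifold_one I M
  have h : mfderiv I 𝓘(ℝ, E2) (extChartAt I p) p = ContinuousLinearMap.id ℝ _ :=
    mfderiv_extChartAt_self
  exact congrArg (fun L => L v) h

theorem surjective_mvfderiv_extChartAt {p : M} {x : E2} (hx : x ∈ (extChartAt I p).target) :
    Function.Surjective (mvfderiv I (extChartAt I p) ((extChartAt I p).symm x)) := by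
  have := isManifold_one I M
  intro u
  exact ⟨_, congrArg (fun L => L u) (mfderiv_extChartAt_comp_mfderivWithin_extChartAt_symm hx)⟩

/-- Only the first factor depends on `f`; the second is the left inverse of the coordinate
derivative of `r`, common to all functions. -/
theorem tderiv_chart (r : M → E3) {f : M → E} (hf : MDifferentiable I 𝓘(ℝ, E) f) {p : M} {x : E2}
    (hx : x ∈ (extChartAt I p).target) :
    tderiv I r f ((extChartAt I p).symm x) =
      (fderivWithin ℝ (f ∘ (extChartAt I p).symm) (Set.range I) x).comp
        (tderiv I r (extChartAt I p) ((extChartAt I p).symm x)) :=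
  ContinuousLinearMap.ext fun _ => mvfderiv_chart hx (hf _) _

theorem eventuallyEq_tderiv (r : M → E3) {f : M → E} (hf : ContMDiff I 𝓘(ℝ, E) ∞ f) (p : M) :
    tderiv I r f ∘ (extChartAt I p).symm =ᶠ[nhdsWithin (extChartAt I p p) (Set.range I)] fun x =>
      (fderivWithin ℝ (f ∘ (extChartAt I p).symm) (Set.range I) x).comp
        (tderiv I r (extChartAt I p) ((extChartAt I p).symm x)) := by
  filter_upwards [extChartAt_target_mem_nhdsWithin p] with x hx using
    tderiv_chart r (hf.mdifferentiable (by simp)) hx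

theorem tderiv_extChartAt_self (r : M → E3) (p : M) (e : E3) :
    tderiv I r (extChartAt I p) p e = tangentialPart I r p e :=
  mvfderiv_extChartAt_self p _

end Chart

/-- A left inverse of an injective map onto a hyperplane can be read off the inverse of the map
extended by the unit normal. -/
theorem isInvertible_coprod_normal {J : E2 →L[ℝ] E3} {ρ : E3 →L[ℝ] E2} {ν : E3}
    (h1 : ∀ e, J (ρ e) = e - inner ℝ ν e • ν) (h2 : ∀ u, ρ (J u) = u) (h3 : ρ ν = 0)
    (h4 : ∀ u, inner ℝ ν (J u) = 0) (h5 : inner ℝ ν ν = (1 : ℝ)) :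
    ∃ e : (E2 × ℝ) ≃L[ℝ] E3,
      (e : (E2 × ℝ) →L[ℝ] E3) = J.comp (ContinuousLinearMap.fst ℝ E2 ℝ) +
        (ContinuousLinearMap.snd ℝ E2 ℝ).smulRight ν ∧
      (ContinuousLinearMap.fst ℝ E2 ℝ).comp (e.symm : E3 →L[ℝ] E2 × ℝ) = ρ := by
  refine ⟨ContinuousLinearEquiv.equivOfInverse
    (J.comp (ContinuousLinearMap.fst ℝ E2 ℝ) + (ContinuousLinearMap.snd ℝ E2 ℝ).smulRight ν)
    (ρ.prod (innerSL ℝ ν)) ?_ ?_, rfl, rfl⟩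
  · rintro ⟨u, t⟩
    simp [h2, h3, h4, h5, inner_add_right, real_inner_smul_right, -inner_self_eq_norm_sq_to_K]
  · intro e
    simp [h1]

/-! ### Smoothness and commutation of tangential derivatives. -/

section Smooth

variable [IsManifold I ∞ M] {r n : M → E3}

namespace IsImmersionWithNormal

variable (hrn : IsImmersionWithNormal I r n)
include hrn

theorem tderiv_extChartAt_fderivWithin {p : M} {x : E2} (hx : x ∈ (extChartAt I p).target)
    (u : E2) :
    tderiv I r (extChartAt I p) ((extChartAt I p).symm x)
      (fderivWithin ℝ (r ∘ (extChartAt I p).symm) (Set.range I) x u) = u := by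
  obtain ⟨v, rfl⟩ := surjective_mvfderiv_extChartAt hx u
  rw [← mvfderiv_chart hx (hrn.mdiff_immersion _), tderiv_apply, hrn.tangentialPart_mvfderiv]

theorem tderiv_extChartAt_eq {p : M} {x : E2} (hx : x ∈ (extChartAt I p).target) :
    ∃ e : (E2 × ℝ) ≃L[ℝ] E3,
      (e : (E2 × ℝ) →L[ℝ] E3) =
        (fderivWithin ℝ (r ∘ (extChartAt I p).symm) (Set.range I) x).comp
          (ContinuousLinearMap.fst ℝ E2 ℝ) +
        (ContinuousLinearMap.snd ℝ E2 ℝ).smulRight (n ((extChartAt I p).symm x)) ∧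
      (ContinuousLinearMap.fst ℝ E2 ℝ).comp (e.symm : E3 →L[ℝ] E2 × ℝ) =
        tderiv I r (extChartAt I p) ((extChartAt I p).symm x) := by
  refine isInvertible_coprod_normal (fun e => ?_) (hrn.tderiv_extChartAt_fderivWithin hx) ?_
    (fun u => ?_) (hrn.inner_normal_self _)
  · rw [tderiv_apply, ← mvfderiv_chart hx (hrn.mdiff_immersion _), hrn.mvfderiv_tangentialPart]
  · rw [tderiv_apply, hrn.tangentialPart_normal, map_zero]
  · obtain ⟨v, rfl⟩ := surjective_mvfderiv_extChartAt hx u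
    rw [← mvfderiv_chart hx (hrn.mdiff_immersion _), real_inner_comm, hrn.orthogonal_normal]

/-- The left inverse of `dr` is the first component of the inverse of `(u, t) ↦ dr(u) + t n`, and
inversion is smooth at invertible linear maps. -/
theorem smooth_tderiv_extChartAt (p : M) :
    ContDiffWithinAt ℝ ∞ (fun x => tderiv I r (extChartAt I p) ((extChartAt I p).symm x))
      (Set.range I) (extChartAt I p p) := by
  let Φ : E2 → (E2 × ℝ) →L[ℝ] E3 := fun x =>
    (fderivWithin ℝ (r ∘ (extChartAt I p).symm) (Set.range I) x).comp
      (ContinuousLinearMap.fst ℝ E2 ℝ) +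
    (ContinuousLinearMap.snd ℝ E2 ℝ).smulRight (n ((extChartAt I p).symm x))
  have hΦ : ContDiffWithinAt ℝ ∞ Φ (Set.range I) (extChartAt I p p) := by
    refine ContDiffWithinAt.add (ContDiffWithinAt.clm_comp ?_ contDiffWithinAt_const)
      (ContDiffWithinAt.smulRight contDiffWithinAt_const (smooth_chart (hrn.smooth_normal p)))
    exact (smooth_chart (hrn.smooth_immersion p)).fderivWithin_right I.uniqueDiffOn (by simp)
      (Set.mem_range_self _)
  obtain ⟨e, he, -⟩ := hrn.tderiv_extChartAt_eq (mem_extChartAt_target (I := I) p)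
  have hinv : ContDiffAt ℝ ∞ ContinuousLinearMap.inverse (Φ (extChartAt I p p)) := by
    rw [← show (e : (E2 × ℝ) →L[ℝ] E3) = Φ (extChartAt I p p) from he]
    exact contDiffAt_map_inverse e
  have h : ContDiffWithinAt ℝ ∞ (fun x => (ContinuousLinearMap.fst ℝ E2 ℝ).comp
      (ContinuousLinearMap.inverse (Φ x))) (Set.range I) (extChartAt I p p) :=
    ContDiffWithinAt.clm_comp contDiffWithinAt_const (hinv.comp_contDiffWithinAt _ hΦ)
  have heq {x : E2} (hx : x ∈ (extChartAt I p).target) :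
      tderiv I r (extChartAt I p) ((extChartAt I p).symm x) =
        (ContinuousLinearMap.fst ℝ E2 ℝ).comp (ContinuousLinearMap.inverse (Φ x)) := by
    obtain ⟨e, he, h2⟩ := hrn.tderiv_extChartAt_eq hx
    rw [← h2, ← show (e : (E2 × ℝ) →L[ℝ] E3) = Φ x from he, ContinuousLinearMap.inverse_equiv]
  refine h.congr_of_eventuallyEq ?_ (heq (mem_extChartAt_target p))
  filter_upwards [extChartAt_target_mem_nhdsWithin p] with x hx using heq hx

theorem smooth_tderiv {f : M → E} (hf : ContMDiff I 𝓘(ℝ, E) ∞ f) :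
    ContMDiff I 𝓘(ℝ, E3 →L[ℝ] E) ∞ (tderiv I r f) := by
  intro p
  rw [contMDiffAt_iff_source, contMDiffWithinAt_iff_contDiffWithinAt]
  have h := (smooth_fderivWithin_chart hf p).clm_comp (hrn.smooth_tderiv_extChartAt p)
  exact h.congr_of_eventuallyEq (eventuallyEq_tderiv r hf p)
    (tderiv_chart r (hf.mdifferentiable (by simp)) (mem_extChartAt_target p))

theorem tderiv_tderiv {f : M → E} (hf : ContMDiff I 𝓘(ℝ, E) ∞ f) (p : M) (a b : E3) :
    tderiv I r (tderiv I r f) p a b =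
      fderivWithin ℝ (fderivWithin ℝ (f ∘ (extChartAt I p).symm) (Set.range I)) (Set.range I)
        (extChartAt I p p) (tderiv I r (extChartAt I p) p a) (tderiv I r (extChartAt I p) p b) +
      fderivWithin ℝ (f ∘ (extChartAt I p).symm) (Set.range I) (extChartAt I p p)
        (fderivWithin ℝ (fun x => tderiv I r (extChartAt I p) ((extChartAt I p).symm x))
          (Set.range I) (extChartAt I p p) (tderiv I r (extChartAt I p) p a) b) := by
  rw [tderiv_apply, mvfderiv_eq_fderivWithin ((hrn.smooth_tderiv hf).mdifferentiable (by simp) p),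
    (eventuallyEq_tderiv r hf p).fderivWithin_eq
      (tderiv_chart r (hf.mdifferentiable (by simp)) (mem_extChartAt_target p)),
    ← tderiv_extChartAt_self r,
    fderivWithin_clm_comp (uniqueDiffWithinAt_range p)
      ((smooth_fderivWithin_chart hf p).differentiableWithinAt (by simp))
      ((hrn.smooth_tderiv_extChartAt p).differentiableWithinAt (by simp))]
  simp only [extChartAt_to_inv]
  exact add_comm _ _

/-- The coordinate second derivatives are symmetric, so the defect is the coordinate derivative of
`f` applied to a vector `δ` of the plane, the same for every `f`. For `f = r` the defect is the
coordinate derivative of `r` at `δ`, from which the left inverse recovers `δ`; this eliminates the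
chart. -/
theorem tderiv_commutator {f : M → E} (hf : ContMDiff I 𝓘(ℝ, E) ∞ f) (p : M) (a b : E3) :
    tderiv I r (tderiv I r f) p a b - tderiv I r (tderiv I r f) p b a =
      tderiv I r f p (tderiv I r (tderiv I r r) p a b - tderiv I r (tderiv I r r) p b a) := by
  have h := tderiv_chart r (hf.mdifferentiable (by simp)) (mem_extChartAt_target (I := I) p)
  have hr := hrn.tderiv_extChartAt_fderivWithin (mem_extChartAt_target (I := I) p)
  rw [extChartAt_to_inv] at h hr
  rw [h, hrn.tderiv_tderiv hf, hrn.tderiv_tderiv hf, hrn.tderiv_tderiv hrn.smooth_immersion,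
    hrn.tderiv_tderiv hrn.smooth_immersion, isSymm_chart hf,
    isSymm_chart hrn.smooth_immersion, add_sub_add_left_eq_sub, add_sub_add_left_eq_sub,
    ← map_sub, ← map_sub, ContinuousLinearMap.comp_apply, hr]

end IsImmersionWithNormal
end Smooth

end

section

variable {H₀ : Type*} [TopologicalSpace H₀] {I : ModelWithCorners ℝ E2 H₀}
  {M : Type*} [TopologicalSpace M] [ChartedSpace H₀ M] {r n : M → E3}

/-! ### The Levi-Civita connection is the tangential part of the ambient derivative -/

theorem tangentBasis_apply (p : M) (i : Fin 2) :
    tangentBasis I p i = (EuclideanSpace.single i (1 : ℝ) : E2) := by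
  change (EuclideanSpace.basisFun (Fin 2) ℝ).toBasis i = _
  simp

theorem sum_smul_tangentBasis (p : M) (u : E2) :
    ∑ k, u k • tangentBasis I p k = (u : TangentSpace I p) :=
  (EuclideanSpace.basisFun (Fin 2) ℝ).sum_repr u

theorem tangentialPart_eq_sum (p : M) (w : E3) :
    tangentialPart I r p w = ∑ k, (∑ l, invGram I r p k l *
      inner ℝ w (mvfderiv I r p (tangentBasis I p l))) • tangentBasis I p k := by
  rw [tangentialPart, LinearMap.comp_apply, sharp, Matrix.toLin_apply]
  simp only [Matrix.mulVec, dotProduct, Module.Basis.dualBasis_repr]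
  rfl

namespace IsImmersionWithNormal

variable (hrn : IsImmersionWithNormal I r n)
include hrn

theorem mvfderiv_tangentBasis (p : M) (i : Fin 2) :
    mvfderiv I r p (tangentBasis I p i) =
      coordDeriv I (r ∘ (extChartAt I p).symm) i (extChartAt I p p) := by
  rw [mvfderiv_eq_fderivWithin (hrn.mdiff_immersion p), tangentBasis_apply]
  rfl

theorem gram_eq (p : M) :
    (Matrix.of fun a b => chartMetric I r p a b (extChartAt I p p))⁻¹ = invGram I r p := by
  rw [invGram]
  congr 1
  ext a b
  simp only [Matrix.of_apply, metric_apply, hrn.mvfderiv_tangentBasis]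
  rfl

theorem coordDeriv_chartMetric (p : M) (i j l : Fin 2) :
    coordDeriv I (chartMetric I r p j l) i (extChartAt I p p) =
      inner ℝ (fderivWithin ℝ (fderivWithin ℝ (r ∘ (extChartAt I p).symm) (Set.range I))
          (Set.range I) (extChartAt I p p) (EuclideanSpace.single i 1)
          (EuclideanSpace.single j 1)) (mvfderiv I r p (tangentBasis I p l)) +
      inner ℝ (fderivWithin ℝ (fderivWithin ℝ (r ∘ (extChartAt I p).symm) (Set.range I))
          (Set.range I) (extChartAt I p p) (EuclideanSpace.single i 1)
          (EuclideanSpace.single l 1)) (mvfderiv I r p (tangentBasis I p j)) := by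
  have hJ := (smooth_fderivWithin_chart hrn.smooth_immersion p).differentiableWithinAt (by simp)
  have hd (k : Fin 2) := hJ.hasFDerivWithinAt.clm_apply (hasFDerivWithinAt_const
    (EuclideanSpace.single k (1 : ℝ) : E2) (extChartAt I p p) (Set.range I))
  have h := ((hd j).inner ℝ (hd l)).fderivWithin (uniqueDiffWithinAt_range p)
  rw [hrn.mvfderiv_tangentBasis, hrn.mvfderiv_tangentBasis]
  refine (congrArg (fun L => L (EuclideanSpace.single i (1 : ℝ))) h).trans ?_
  simp only [ContinuousLinearMap.comp_apply, fderivInnerCLM_apply, ContinuousLinearMap.prod_apply,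
    add_apply, ContinuousLinearMap.flip_apply, zero_apply,
    map_zero, zero_add]
  rw [add_comm, real_inner_comm (coordDeriv I (r ∘ (extChartAt I p).symm) j (extChartAt I p p))]
  rfl

/-- By symmetry of `∂ᵢ∂ⱼ r`, four of the six terms in the metric derivatives cancel and the other
two coincide. So `Γ^k_{ij}` are the components of the tangential part of `∂ᵢ∂ⱼ r`. -/
theorem christoffel_eq (p : M) (k i j : Fin 2) :
    christoffel I r p k i j (extChartAt I p p) = ∑ l, invGram I r p k l *
      inner ℝ (fderivWithin ℝ (fderivWithin ℝ (r ∘ (extChartAt I p).symm) (Set.range I))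
          (Set.range I) (extChartAt I p p) (EuclideanSpace.single i 1)
          (EuclideanSpace.single j 1)) (mvfderiv I r p (tangentBasis I p l)) := by
  rw [christoffel, hrn.gram_eq, Finset.mul_sum]
  refine Finset.sum_congr rfl fun l _ => ?_
  have hs := isSymm_chart hrn.smooth_immersion p
  rw [hrn.coordDeriv_chartMetric, hrn.coordDeriv_chartMetric, hrn.coordDeriv_chartMetric,
    hs (EuclideanSpace.single j 1) (EuclideanSpace.single i 1),
    hs (EuclideanSpace.single l 1) (EuclideanSpace.single i 1),
    hs (EuclideanSpace.single l 1) (EuclideanSpace.single j 1)]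
  ring

/-- Recovering the components from `dr(X)` lets differentiability of this ambient field pass to
them. -/
theorem chartField_eq (X : Π q : M, TangentSpace I q) (p : M) (k : Fin 2) (x : E2) :
    chartField I X p k x = tderiv I r (extChartAt I p) ((extChartAt I p).symm x)
      (mvfderiv I r ((extChartAt I p).symm x) (X ((extChartAt I p).symm x))) k := by
  rw [tderiv_apply, hrn.tangentialPart_mvfderiv]
  rfl

variable [IsManifold I ∞ M]

/-- In the chart `dr(X) = J ξ`, with `J` the coordinate derivative of `r`. The tangential part of
`(∂ᵢJ) ξ + J ∂ᵢξ` has the Christoffel term from the first summand and `∂ᵢξ` from the second. -/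
theorem covDeriv_eq (X : Π q : M, TangentSpace I q) (p : M)
    (hV : MDifferentiableAt I 𝓘(ℝ, E3) (fun q => mvfderiv I r q (X q)) p)
    (v : TangentSpace I p) :
    covDeriv I r X p v =
      tangentialPart I r p (mvfderiv I (fun q => mvfderiv I r q (X q)) p v) := by
  suffices h : covDeriv I r X p = (tangentialPart I r p) ∘ₗ
      (mvfderiv I (fun q => mvfderiv I r q (X q)) p : TangentSpace I p →ₗ[ℝ] E3) from
    congrArg (fun L => L v) h
  refine (tangentBasis I p).ext fun i => ?_
  set V : M → E3 := fun q => mvfderiv I r q (X q) with hVdef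
  set φ := extChartAt I p with hφ
  set ρ : E2 → E3 →L[ℝ] E2 := fun x => tderiv I r φ (φ.symm x) with hρ
  set J : E2 → E2 →L[ℝ] E3 := fderivWithin ℝ (r ∘ φ.symm) (Set.range I) with hJ
  set ξ : E2 → E2 := fun x => ρ x (V (φ.symm x)) with hξ
  have hdρ : DifferentiableWithinAt ℝ ρ (Set.range I) (φ p) :=
    (hrn.smooth_tderiv_extChartAt p).differentiableWithinAt (by simp)
  have hdJ : DifferentiableWithinAt ℝ J (Set.range I) (φ p) :=
    (smooth_fderivWithin_chart hrn.smooth_immersion p).differentiableWithinAt (by simp)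
  have hdξ : DifferentiableWithinAt ℝ ξ (Set.range I) (φ p) :=
    hdρ.clm_apply (differentiableWithinAt_chart hV)
  have hVJ {x : E2} (hx : x ∈ φ.target) : (V ∘ φ.symm) x = J x (ξ x) := by
    have : ξ x = mvfderiv I φ (φ.symm x) (X (φ.symm x)) :=
      congrArg (mvfderiv I φ (φ.symm x)) (hrn.tangentialPart_mvfderiv (φ.symm x) _)
    rw [this]
    exact mvfderiv_chart hx (hrn.mdiff_immersion _) _
  have hDV : mvfderiv I V p (tangentBasis I p i) =
      fderivWithin ℝ J (Set.range I) (φ p) (EuclideanSpace.single i 1) (ξ (φ p)) +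
        J (φ p) (fderivWithin ℝ ξ (Set.range I) (φ p) (EuclideanSpace.single i 1)) := by
    have hev : V ∘ φ.symm =ᶠ[nhdsWithin (φ p) (Set.range I)] fun x => J x (ξ x) := by
      filter_upwards [extChartAt_target_mem_nhdsWithin p] with x hx using hVJ hx
    rw [mvfderiv_eq_fderivWithin hV, tangentBasis_apply,
      hev.fderivWithin_eq (hVJ (mem_extChartAt_target p)),
      fderivWithin_clm_apply (uniqueDiffWithinAt_range p) hdJ hdξ]
    exact add_comm _ _
  have hπ (w : E2) : tangentialPart I r p (J (φ p) w) = w := by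
    have := hrn.tangentialPart_mvfderiv p w
    rwa [mvfderiv_eq_fderivWithin (hrn.mdiff_immersion p)] at this
  have hcf (k : Fin 2) : chartField I X p k = fun x => ξ x k :=
    funext fun x => hrn.chartField_eq X p k x
  have hdcf (k : Fin 2) : coordDeriv I (chartField I X p k) i (φ p) =
      fderivWithin ℝ ξ (Set.range I) (φ p) (EuclideanSpace.single i 1) k := by
    rw [hcf]
    have := ((EuclideanSpace.proj k : E2 →L[ℝ] ℝ).hasFDerivAt.comp_hasFDerivWithinAt (φ p)
      hdξ.hasFDerivWithinAt).fderivWithin (uniqueDiffWithinAt_range p)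
    exact congrArg (fun L => L (EuclideanSpace.single i (1 : ℝ))) this
  rw [LinearMap.comp_apply, covDeriv, Matrix.toLin_self]
  refine Eq.trans ?_ (congrArg (tangentialPart I r p) hDV).symm
  rw [map_add, hπ]
  have hsum : ∑ k, (∑ j, christoffel I r p k i j (φ p) * ξ (φ p) j) • tangentBasis I p k =
      tangentialPart I r p
        (fderivWithin ℝ J (Set.range I) (φ p) (EuclideanSpace.single i 1) (ξ (φ p))) := by
    have hξs : ξ (φ p) = ∑ j, ξ (φ p) j • (EuclideanSpace.single j (1 : ℝ) : E2) := by
      simpa using ((EuclideanSpace.basisFun (Fin 2) ℝ).sum_repr (ξ (φ p))).symm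
    conv_rhs => rw [hξs]
    rw [map_sum, tangentialPart_eq_sum]
    refine Finset.sum_congr rfl fun k _ => congrArg (· • tangentBasis I p k) ?_
    simp only [map_smul, sum_inner, real_inner_smul_left, Finset.mul_sum]
    rw [Finset.sum_comm]
    refine Finset.sum_congr rfl fun j _ => ?_
    rw [hrn.christoffel_eq, Finset.sum_mul]
    refine Finset.sum_congr rfl fun l _ => ?_
    ring
  rw [← hsum, ← sum_smul_tangentBasis p
    (fderivWithin ℝ ξ (Set.range I) (φ p) (EuclideanSpace.single i 1)), ← Finset.sum_add_distrib]
  refine Finset.sum_congr rfl fun k _ => ?_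
  rw [← add_smul, Matrix.of_apply, hdcf, add_comm]
  simp only [hcf]
  rfl

end IsImmersionWithNormal

end

/-! ### Traces, Cayley-Hamilton and the calculus of the ambient shape operator. -/

section

/-- The trace of an endomorphism of `ℝ³`, as a continuous linear form. -/
def tr : (E3 →L[ℝ] E3) →L[ℝ] ℝ :=
  LinearMap.toContinuousLinearMap (LinearMap.trace ℝ E3 ∘ₗ ContinuousLinearMap.coeLM ℝ)

theorem tr_apply (A : E3 →L[ℝ] E3) : tr A = LinearMap.trace ℝ E3 (A : E3 →ₗ[ℝ] E3) := rfl

theorem tr_smulRight (ℓ : E3 →L[ℝ] ℝ) (v : E3) : tr (ℓ.smulRight v) = ℓ v :=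
  LinearMap.trace_smulRight (ℓ : E3 →ₗ[ℝ] ℝ) v

theorem apply_apply_eq_of_finrank_two {V : Type*} [AddCommGroup V] [Module ℝ V]
    (b : Module.Basis (Fin 2) ℝ V) (f : V →ₗ[ℝ] V) (v : V) :
    f (f v) = LinearMap.trace ℝ V f • f v - LinearMap.det f • v := by
  suffices h : f ∘ₗ f = LinearMap.trace ℝ V f • f - LinearMap.det f • LinearMap.id from
    congrArg (fun L => L v) h
  apply (LinearMap.toMatrix b b).injective
  rw [LinearMap.toMatrix_comp b b b, map_sub, map_smul, map_smul, LinearMap.toMatrix_id,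
    LinearMap.trace_eq_matrix_trace ℝ b, ← LinearMap.det_toMatrix b]
  generalize LinearMap.toMatrix b b f = A
  ext i j
  fin_cases i <;> fin_cases j <;>
    simp [Matrix.mul_apply, Fin.sum_univ_two, Matrix.trace_fin_two, Matrix.det_fin_two] <;> ring

variable {H₀ : Type*} [TopologicalSpace H₀] {I : ModelWithCorners ℝ E2 H₀}
  {M : Type*} [TopologicalSpace M] [ChartedSpace H₀ M] {r n : M → E3}
  {E F G : Type*} [NormedAddCommGroup E] [NormedSpace ℝ E] [NormedAddCommGroup F]
  [NormedSpace ℝ F] [NormedAddCommGroup G] [NormedSpace ℝ G]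

/-! ### Rules for the tangential derivative -/

theorem tderiv_const (c : E) (p : M) (a : E3) : tderiv I r (fun _ => c) p a = 0 := by
  rw [tderiv_apply, mvfderiv_const]
  rfl

theorem tderiv_bilin (B : E →L[ℝ] F →L[ℝ] G) {f : M → E} {g : M → F}
    (hf : ContMDiff I 𝓘(ℝ, E) ∞ f) (hg : ContMDiff I 𝓘(ℝ, F) ∞ g) (p : M) (a : E3) :
    tderiv I r (fun q => B (f q) (g q)) p a =
      B (tderiv I r f p a) (g p) + B (f p) (tderiv I r g p a) :=
  mvfderiv_bilin B (hf.mdifferentiable (by simp) p) (hg.mdifferentiable (by simp) p) _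

theorem tderiv_comp_fderiv {g : E → F} {f : M → E} {p : M} (hg : DifferentiableAt ℝ g (f p))
    (hf : ContMDiff I 𝓘(ℝ, E) ∞ f) (a : E3) :
    tderiv I r (fun q => g (f q)) p a = fderiv ℝ g (f p) (tderiv I r f p a) :=
  mvfderiv_comp_fderiv hg (hf.mdifferentiable (by simp) p) _

theorem tderiv_clm (L : E →L[ℝ] F) {f : M → E} (hf : ContMDiff I 𝓘(ℝ, E) ∞ f) (p : M) (a : E3) :
    tderiv I r (fun q => L (f q)) p a = L (tderiv I r f p a) := by
  rw [tderiv_comp_fderiv L.differentiableAt hf, L.fderiv]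

theorem tderiv_clm_apply {f : M → E →L[ℝ] F} {g : M → E}
    (hf : ContMDiff I 𝓘(ℝ, E →L[ℝ] F) ∞ f) (hg : ContMDiff I 𝓘(ℝ, E) ∞ g) (p : M) (a : E3) :
    tderiv I r (fun q => f q (g q)) p a = tderiv I r f p a (g p) + f p (tderiv I r g p a) :=
  tderiv_bilin (ContinuousLinearMap.id ℝ (E →L[ℝ] F)) hf hg p a

theorem tderiv_eval {f : M → E →L[ℝ] F} (hf : ContMDiff I 𝓘(ℝ, E →L[ℝ] F) ∞ f) (w : E) (p : M)
    (a : E3) : tderiv I r (fun q => f q w) p a = tderiv I r f p a w :=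
  tderiv_clm (ContinuousLinearMap.apply ℝ F w) hf p a

theorem tderiv_inner {f g : M → E3} (hf : ContMDiff I 𝓘(ℝ, E3) ∞ f)
    (hg : ContMDiff I 𝓘(ℝ, E3) ∞ g) (p : M) (a : E3) :
    tderiv I r (fun q => inner ℝ (f q) (g q)) p a =
      inner ℝ (tderiv I r f p a) (g p) + inner ℝ (f p) (tderiv I r g p a) :=
  tderiv_bilin (innerSL ℝ) hf hg p a

theorem tderiv_smul {f : M → ℝ} {g : M → E} (hf : ContMDiff I 𝓘(ℝ, ℝ) ∞ f)
    (hg : ContMDiff I 𝓘(ℝ, E) ∞ g) (p : M) (a : E3) :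
    tderiv I r (fun q => f q • g q) p a = tderiv I r f p a • g p + f p • tderiv I r g p a :=
  tderiv_bilin (ContinuousLinearMap.lsmul ℝ ℝ) hf hg p a

theorem tderiv_add {f g : M → E} (hf : ContMDiff I 𝓘(ℝ, E) ∞ f) (hg : ContMDiff I 𝓘(ℝ, E) ∞ g)
    (p : M) (a : E3) :
    tderiv I r (fun q => f q + g q) p a = tderiv I r f p a + tderiv I r g p a :=
  congrArg (fun L => L (tangentialPart I r p a))
    (mvfderiv_fun_add (hf.mdifferentiable (by simp) p) (hg.mdifferentiable (by simp) p))

theorem tderiv_sub {f g : M → E} (hf : ContMDiff I 𝓘(ℝ, E) ∞ f) (hg : ContMDiff I 𝓘(ℝ, E) ∞ g)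
    (p : M) (a : E3) :
    tderiv I r (fun q => f q - g q) p a = tderiv I r f p a - tderiv I r g p a :=
  congrArg (fun L => L (tangentialPart I r p a))
    (mvfderiv_fun_sub (hf.mdifferentiable (by simp) p) (hg.mdifferentiable (by simp) p))

theorem smooth_clm_apply {f : M → E →L[ℝ] F} {g : M → E}
    (hf : ContMDiff I 𝓘(ℝ, E →L[ℝ] F) ∞ f) (hg : ContMDiff I 𝓘(ℝ, E) ∞ g) :
    ContMDiff I 𝓘(ℝ, F) ∞ (fun q => f q (g q)) :=
  smooth_bilin (ContinuousLinearMap.id ℝ (E →L[ℝ] F)) hf hg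

theorem smooth_eval {f : M → E →L[ℝ] F} (hf : ContMDiff I 𝓘(ℝ, E →L[ℝ] F) ∞ f) (w : E) :
    ContMDiff I 𝓘(ℝ, F) ∞ (fun q => f q w) :=
  smooth_clm (ContinuousLinearMap.apply ℝ F w) hf

theorem smooth_inner {f g : M → E3} (hf : ContMDiff I 𝓘(ℝ, E3) ∞ f)
    (hg : ContMDiff I 𝓘(ℝ, E3) ∞ g) : ContMDiff I 𝓘(ℝ, ℝ) ∞ (fun q => inner ℝ (f q) (g q)) :=
  smooth_bilin (innerSL ℝ) hf hg

theorem smooth_smul {f : M → ℝ} {g : M → E} (hf : ContMDiff I 𝓘(ℝ, ℝ) ∞ f)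
    (hg : ContMDiff I 𝓘(ℝ, E) ∞ g) : ContMDiff I 𝓘(ℝ, E) ∞ (fun q => f q • g q) :=
  smooth_bilin (ContinuousLinearMap.lsmul ℝ ℝ) hf hg

/-! ### The shape operator as an operator on the ambient space -/

/-- The shape operator, extended by zero on the normal line. -/
def ambientShape (I : ModelWithCorners ℝ E2 H₀) (r n : M → E3) (p : M) : E3 →L[ℝ] E3 :=
  -tderiv I r n p

theorem ambientShape_apply (p : M) (e : E3) : ambientShape I r n p e = -tderiv I r n p e := rfl

/-- The divergence of an ambient vector field along the surface. -/
def ambientDiv (I : ModelWithCorners ℝ E2 H₀) (r : M → E3) (V : M → E3) (p : M) : ℝ :=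
  tr (tderiv I r V p)

theorem shape_shape (p : M) (v : TangentSpace I p) :
    shape I r n p (shape I r n p v) =
      meanCurv I r n p • shape I r n p v - gaussCurv I r n p • v :=
  apply_apply_eq_of_finrank_two (tangentBasis I p) _ v

namespace IsImmersionWithNormal

variable (hrn : IsImmersionWithNormal I r n)
include hrn

theorem tderiv_immersion (p : M) (e : E3) :
    tderiv I r r p e = e - inner ℝ (n p) e • n p := hrn.mvfderiv_tangentialPart p e

theorem tderiv_normal_direction (f : M → E) (p : M) : tderiv I r f p (n p) = 0 := by
  rw [tderiv_apply, hrn.tangentialPart_normal, map_zero]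

theorem tderiv_tangential (f : M → E) (p : M) (e : E3) :
    tderiv I r f p (e - inner ℝ (n p) e • n p) = tderiv I r f p e := by
  rw [map_sub, map_smul, hrn.tderiv_normal_direction, smul_zero, sub_zero]

theorem tderiv_mvfderiv (f : M → E) (p : M) (v : TangentSpace I p) :
    tderiv I r f p (mvfderiv I r p v) = mvfderiv I f p v := by
  rw [tderiv_apply, hrn.tangentialPart_mvfderiv]

theorem inner_normal_ambientShape (p : M) (e : E3) :
    inner ℝ (n p) (ambientShape I r n p e) = 0 := by
  rw [ambientShape_apply, inner_neg_right, tderiv_apply, hrn.inner_mvfderiv_normal, neg_zero]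

theorem ambientShape_mvfderiv (p : M) (v : TangentSpace I p) :
    ambientShape I r n p (mvfderiv I r p v) = mvfderiv I r p (shape I r n p v) := by
  rw [ambientShape_apply, hrn.tderiv_mvfderiv, hrn.mvfderiv_shape]

theorem mvfderiv_shape_tangentialPart (p : M) (e : E3) :
    mvfderiv I r p (shape I r n p (tangentialPart I r p e)) = ambientShape I r n p e := by
  rw [hrn.mvfderiv_shape, ambientShape_apply, tderiv_apply]

/-- The trace of a tangential operator is that of its ambient extension. -/
theorem trace_eq_tr (p : M) (L : TangentSpace I p →ₗ[ℝ] TangentSpace I p) (A : E3 →L[ℝ] E3)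
    (h : ∀ e, A e = mvfderiv I r p (L (tangentialPart I r p e))) :
    LinearMap.trace ℝ _ L = tr A := by
  have hA : (A : E3 →ₗ[ℝ] E3) = (mvfderiv I r p : TangentSpace I p →ₗ[ℝ] E3) ∘ₗ
      (L ∘ₗ tangentialPart I r p) := LinearMap.ext h
  -- Cyclicity of the trace puts the tangential projection next to `dr`, where the two cancel.
  rw [tr_apply, hA, LinearMap.trace_comp_comm']
  congr 1
  exact LinearMap.ext fun v => congrArg L (hrn.tangentialPart_mvfderiv p v).symm

theorem meanCurv_eq (p : M) : meanCurv I r n p = tr (ambientShape I r n p) :=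
  hrn.trace_eq_tr p _ _ fun e => (hrn.mvfderiv_shape_tangentialPart p e).symm

theorem trace_shape_comp (p : M) : LinearMap.trace ℝ _ (shape I r n p ∘ₗ shape I r n p) =
    tr ((ambientShape I r n p).comp (ambientShape I r n p)) := by
  refine hrn.trace_eq_tr p _ _ fun e => ?_
  rw [ContinuousLinearMap.comp_apply, LinearMap.comp_apply, ← hrn.ambientShape_mvfderiv,
    hrn.mvfderiv_shape_tangentialPart]

theorem ambientShape_ambientShape (p : M) (e : E3) :
    ambientShape I r n p (ambientShape I r n p e) = meanCurv I r n p • ambientShape I r n p e -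
      gaussCurv I r n p • (e - inner ℝ (n p) e • n p) := by
  rw [← hrn.mvfderiv_shape_tangentialPart p e, hrn.ambientShape_mvfderiv, shape_shape, map_sub,
    map_smul, map_smul, hrn.mvfderiv_tangentialPart]

/-- The trace of Cayley-Hamilton reads `tr S² = H² - 2K`, with `2` the dimension of the tangent
plane. Written through traces, `K` is visibly smooth. -/
theorem gaussCurv_eq (p : M) : gaussCurv I r n p = (1 / 2) * (tr (ambientShape I r n p) ^ 2 -
    tr ((ambientShape I r n p).comp (ambientShape I r n p))) := by
  have h : shape I r n p ∘ₗ shape I r n p =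
      meanCurv I r n p • shape I r n p - gaussCurv I r n p • LinearMap.id :=
    LinearMap.ext fun v => by rw [LinearMap.comp_apply, shape_shape]; rfl
  have h2 := congrArg (LinearMap.trace ℝ (TangentSpace I p)) h
  rw [hrn.trace_shape_comp, map_sub, map_smul, map_smul, LinearMap.trace_id, finrank_tangentSpace,
    smul_eq_mul, smul_eq_mul, ← meanCurv] at h2
  rw [h2, ← hrn.meanCurv_eq]
  push_cast
  ring

variable [IsManifold I ∞ M]

theorem divergence_eq (X : Π q : M, TangentSpace I q) (p : M)
    (hV : ContMDiff I 𝓘(ℝ, E3) ∞ (fun q => mvfderiv I r q (X q))) :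
    divergence I r X p = ambientDiv I r (fun q => mvfderiv I r q (X q)) p := by
  have h : covDeriv I r X p = (tangentialPart I r p) ∘ₗ
      (mvfderiv I (fun q => mvfderiv I r q (X q)) p : TangentSpace I p →ₗ[ℝ] E3) :=
    LinearMap.ext fun v => hrn.covDeriv_eq X p (hV.mdifferentiable (by simp) p) v
  rw [divergence, h, LinearMap.trace_comp_comm']
  rfl

theorem smooth_tderiv_normal : ContMDiff I 𝓘(ℝ, E3 →L[ℝ] E3) ∞ (tderiv I r n) :=
  hrn.smooth_tderiv hrn.smooth_normal

theorem smooth_ambientShape : ContMDiff I 𝓘(ℝ, E3 →L[ℝ] E3) ∞ (ambientShape I r n) :=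
  smooth_clm (-ContinuousLinearMap.id ℝ (E3 →L[ℝ] E3)) hrn.smooth_tderiv_normal

theorem smooth_meanCurv : ContMDiff I 𝓘(ℝ, ℝ) ∞ (meanCurv I r n) := by
  rw [show meanCurv I r n = _ from funext hrn.meanCurv_eq]
  exact smooth_clm tr hrn.smooth_ambientShape

theorem smooth_gaussCurv : ContMDiff I 𝓘(ℝ, ℝ) ∞ (gaussCurv I r n) := by
  have h1 : ContMDiff I 𝓘(ℝ, ℝ) ∞ (fun p => tr (ambientShape I r n p)) :=
    smooth_clm tr hrn.smooth_ambientShape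
  have h2 : ContMDiff I 𝓘(ℝ, ℝ) ∞
      (fun p => tr ((ambientShape I r n p).comp (ambientShape I r n p))) :=
    smooth_clm tr (smooth_bilin (ContinuousLinearMap.compL ℝ E3 E3 E3)
      hrn.smooth_ambientShape hrn.smooth_ambientShape)
  have h3 : ContDiff ℝ ∞ (fun z : ℝ × ℝ => (1 / 2) * (z.1 ^ 2 - z.2)) := by fun_prop
  have h4 := h3.comp_contMDiff (h1.prodMk_space h2)
  rwa [show gaussCurv I r n = _ from funext hrn.gaussCurv_eq]

/-! ### Symmetry of the shape operator and the Codazzi equation. -/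

theorem tderiv_tderiv_immersion (p : M) (a b : E3) :
    tderiv I r (tderiv I r r) p a b =
      -(inner ℝ (tderiv I r n p a) b • n p + inner ℝ (n p) b • tderiv I r n p a) := by
  have hn := hrn.smooth_normal
  have hb : ContMDiff I 𝓘(ℝ, ℝ) ∞ (fun q => inner ℝ (n q) b) := smooth_inner hn contMDiff_const
  rw [← tderiv_eval (hrn.smooth_tderiv hrn.smooth_immersion)]
  simp_rw [hrn.tderiv_immersion]
  rw [tderiv_sub contMDiff_const (smooth_smul hb hn), tderiv_const, tderiv_smul hb hn,
    tderiv_inner hn contMDiff_const, tderiv_const, inner_zero_right, add_zero, zero_sub]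

theorem inner_tderiv_normal (p : M) (a b : E3) :
    inner ℝ (tderiv I r n p a) b = -inner ℝ (n p) (tderiv I r (tderiv I r r) p a b) := by
  rw [hrn.tderiv_tderiv_immersion, inner_neg_right, inner_add_right, real_inner_smul_right,
    real_inner_smul_right, hrn.inner_normal_self, tderiv_apply, hrn.inner_mvfderiv_normal]
  ring

/-- By the commutator formula for `r`, the defect is itself a value of `tderiv r`, hence tangential,
and its normal component vanishes. -/
theorem inner_tderiv_normal_comm (p : M) (a b : E3) :
    inner ℝ (tderiv I r n p a) b = inner ℝ (tderiv I r n p b) a := by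
  have h : inner ℝ (n p) (tderiv I r (tderiv I r r) p a b - tderiv I r (tderiv I r r) p b a) =
      0 := by
    rw [hrn.tderiv_commutator hrn.smooth_immersion, tderiv_apply, real_inner_comm,
      hrn.orthogonal_normal]
  rw [inner_sub_right, sub_eq_zero] at h
  rw [hrn.inner_tderiv_normal, hrn.inner_tderiv_normal, h]

theorem inner_ambientShape_comm (p : M) (a b : E3) :
    inner ℝ (ambientShape I r n p a) b = inner ℝ a (ambientShape I r n p b) := by
  rw [ambientShape_apply, ambientShape_apply, inner_neg_left, inner_neg_right,
    hrn.inner_tderiv_normal_comm, real_inner_comm]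

theorem tderiv_ambientShape (p : M) (a b : E3) :
    tderiv I r (ambientShape I r n) p a b = -tderiv I r (tderiv I r n) p a b :=
  congrArg (fun L => L b)
    (tderiv_clm (-ContinuousLinearMap.id ℝ (E3 →L[ℝ] E3)) hrn.smooth_tderiv_normal p a)

/-- The Codazzi equation, in terms of the ambient shape operator. -/
theorem codazzi (p : M) (a b : E3) :
    tderiv I r (ambientShape I r n) p a b = tderiv I r (ambientShape I r n) p b a +
      inner ℝ (n p) b • ambientShape I r n p (ambientShape I r n p a) -
      inner ℝ (n p) a • ambientShape I r n p (ambientShape I r n p b) := by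
  -- In the defect of `r` the multiples of `n` are killed by `tderiv n`; the surviving terms give
  -- the `A²` corrections, due to `A` being extended by zero along a varying normal.
  have h := hrn.tderiv_commutator hrn.smooth_normal p a b
  rw [hrn.tderiv_tderiv_immersion, hrn.tderiv_tderiv_immersion,
    hrn.inner_tderiv_normal_comm p a b] at h
  simp only [hrn.tderiv_ambientShape, ambientShape_apply]
  simp only [map_neg, map_sub, map_add, map_smul, hrn.tderiv_normal_direction] at h ⊢
  rw [sub_eq_iff_eq_add] at h
  rw [h]
  simp only [smul_zero, neg_neg]
  abel

/-- Contracted Codazzi equation. One of the two corrections has trace `⟨n, A(A w)⟩ = 0`, the other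
contributes `|h|²`. -/
theorem tr_flip_tderiv_ambientShape (p : M) (w : E3) :
    tr ((tderiv I r (ambientShape I r n) p).flip w) = tderiv I r (meanCurv I r n) p w +
      inner ℝ (n p) w * tr ((ambientShape I r n p).comp (ambientShape I r n p)) := by
  have h : (tderiv I r (ambientShape I r n) p).flip w = tderiv I r (ambientShape I r n) p w +
      inner ℝ (n p) w • (ambientShape I r n p).comp (ambientShape I r n p) -
      (innerSL ℝ (n p)).smulRight (ambientShape I r n p (ambientShape I r n p w)) :=
    ContinuousLinearMap.ext fun a => hrn.codazzi p a w
  rw [h, map_sub, map_add, map_smul, tr_smulRight, innerSL_apply_apply,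
    hrn.inner_normal_ambientShape, show meanCurv I r n = _ from funext hrn.meanCurv_eq,
    tderiv_clm tr hrn.smooth_ambientShape]
  simp

end IsImmersionWithNormal

end

section

variable {H₀ : Type*} [TopologicalSpace H₀] {I : ModelWithCorners ℝ E2 H₀}
  {M : Type*} [TopologicalSpace M] [ChartedSpace H₀ M] {r n : M → E3}

/-! ### Divergence, gradient and Hessian in ambient terms -/

theorem ambientDiv_smul {f : M → ℝ} {V : M → E3} (hf : ContMDiff I 𝓘(ℝ, ℝ) ∞ f)
    (hV : ContMDiff I 𝓘(ℝ, E3) ∞ V) (p : M) :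
    ambientDiv I r (fun q => f q • V q) p = tderiv I r f p (V p) + f p * ambientDiv I r V p := by
  have h : tderiv I r (fun q => f q • V q) p =
      (tderiv I r f p).smulRight (V p) + f p • tderiv I r V p :=
    ContinuousLinearMap.ext fun a => tderiv_smul hf hV p a
  rw [ambientDiv, h, map_add, map_smul, tr_smulRight, smul_eq_mul, ambientDiv]

theorem ambientDiv_add {V W : M → E3} (hV : ContMDiff I 𝓘(ℝ, E3) ∞ V)
    (hW : ContMDiff I 𝓘(ℝ, E3) ∞ W) (p : M) :
    ambientDiv I r (fun q => V q + W q) p = ambientDiv I r V p + ambientDiv I r W p := by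
  have h : tderiv I r (fun q => V q + W q) p = tderiv I r V p + tderiv I r W p :=
    ContinuousLinearMap.ext fun a => tderiv_add hV hW p a
  rw [ambientDiv, h, map_add, ambientDiv, ambientDiv]

theorem ambientDiv_sub {V W : M → E3} (hV : ContMDiff I 𝓘(ℝ, E3) ∞ V)
    (hW : ContMDiff I 𝓘(ℝ, E3) ∞ W) (p : M) :
    ambientDiv I r (fun q => V q - W q) p = ambientDiv I r V p - ambientDiv I r W p := by
  have h : tderiv I r (fun q => V q - W q) p = tderiv I r V p - tderiv I r W p :=
    ContinuousLinearMap.ext fun a => tderiv_sub hV hW p a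
  rw [ambientDiv, h, map_sub, ambientDiv, ambientDiv]

theorem ambientDiv_const (c : E3) (p : M) : ambientDiv I r (fun _ => c) p = 0 := by
  have h : tderiv I r (fun _ : M => c) p = 0 :=
    ContinuousLinearMap.ext fun a => tderiv_const c p a
  rw [ambientDiv, h, map_zero]

theorem ambientDiv_normal (p : M) :
    ambientDiv I r n p = -tr (ambientShape I r n p) := by
  rw [ambientShape, map_neg, neg_neg, ambientDiv]

/-- The gradient as a vector field of the ambient space. -/
def ambientGrad (I : ModelWithCorners ℝ E2 H₀) (r : M → E3) (f : M → ℝ) (p : M) : E3 :=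
  mvfderiv I r p (grad I r f p)

theorem metric_comm (p : M) (v w : TangentSpace I p) :
    metric I r p v w = metric I r p w v := by
  rw [metric_apply, metric_apply, real_inner_comm]

theorem invGram_comm (p : M) (i k : Fin 2) : invGram I r p i k = invGram I r p k i := by
  have h : (invGram I r p).transpose = invGram I r p := by
    rw [invGram, Matrix.transpose_nonsing_inv]
    congr 1
    ext a b
    exact metric_comm p _ _
  exact congrFun (congrFun h k) i

namespace IsImmersionWithNormal

variable (hrn : IsImmersionWithNormal I r n)
include hrn

theorem inner_ambientGrad (f : M → ℝ) (p : M) (e : E3) :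
    inner ℝ (ambientGrad I r f p) e = tderiv I r f p e := by
  have h1 : inner ℝ (ambientGrad I r f p) e = inner ℝ (ambientGrad I r f p)
      (mvfderiv I r p (tangentialPart I r p e)) := by
    rw [hrn.mvfderiv_tangentialPart, inner_sub_right, real_inner_smul_right, ambientGrad,
      hrn.orthogonal_normal, mul_zero, sub_zero]
  rw [h1, real_inner_comm]
  exact hrn.metric_sharp p _ _

/-- A fixed linear map takes `tderiv f` to the gradient, which therefore inherits its smoothness. -/
theorem ambientGrad_eq (f : M → ℝ) (p : M) :
    ambientGrad I r f p =
      (∑ a : Fin 3, (ContinuousLinearMap.apply ℝ ℝ (EuclideanSpace.single a (1 : ℝ))).smulRight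
        (EuclideanSpace.single a (1 : ℝ)) : (E3 →L[ℝ] ℝ) →L[ℝ] E3) (tderiv I r f p) := by
  have h := (EuclideanSpace.basisFun (Fin 3) ℝ).sum_repr' (ambientGrad I r f p)
  rw [← h]
  simp only [sum_apply, ContinuousLinearMap.smulRight_apply,
    ContinuousLinearMap.apply_apply, EuclideanSpace.basisFun_apply]
  refine Finset.sum_congr rfl fun a _ => ?_
  rw [real_inner_comm, hrn.inner_ambientGrad]

theorem smooth_ambientGrad [IsManifold I ∞ M] {f : M → ℝ} (hf : ContMDiff I 𝓘(ℝ, ℝ) ∞ f) :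
    ContMDiff I 𝓘(ℝ, E3) ∞ (ambientGrad I r f) := by
  rw [show ambientGrad I r f = _ from funext (hrn.ambientGrad_eq f)]
  exact smooth_clm _ (hrn.smooth_tderiv hf)

theorem repr_tangentBasis (p : M) (u : TangentSpace I p) (k : Fin 2) :
    (tangentBasis I p).repr u k =
      ∑ l, invGram I r p k l * metric I r p u (tangentBasis I p l) := by
  conv_lhs => rw [← hrn.tangentialPart_mvfderiv p u, tangentialPart_eq_sum]
  fin_cases k <;> simp [metric_apply]

theorem formInner_metric_comp (p : M) (S C : TangentSpace I p →ₗ[ℝ] TangentSpace I p)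
    (hS : ∀ v w, metric I r p (S v) w = metric I r p v (S w)) :
    formInner I r p (metric I r p ∘ₗ S) (metric I r p ∘ₗ C) = LinearMap.trace ℝ _ (S ∘ₗ C) := by
  set b := tangentBasis I p with hb
  -- Contraction with `g^{jl}` expands `C b_k` in the basis; symmetry of `S` then moves it to the
  -- other slot.
  have h1 (i k : Fin 2) : ∑ j, ∑ l, invGram I r p j l * metric I r p (S (b i)) (b j) *
      metric I r p (C (b k)) (b l) = metric I r p (b i) (S (C (b k))) := by
    rw [← hS]
    conv_rhs => rw [← b.sum_repr (C (b k))]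
    rw [map_sum]
    refine Finset.sum_congr rfl fun j _ => ?_
    rw [map_smul, hrn.repr_tangentBasis, smul_eq_mul, Finset.sum_mul]
    exact Finset.sum_congr rfl fun l _ => by rw [← hb]; ring
  rw [LinearMap.trace_eq_matrix_trace ℝ b, Matrix.trace]
  simp only [Matrix.diag_apply, LinearMap.toMatrix_apply, formInner,
    LinearMap.comp_apply]
  rw [← hb]
  have h2 : ∀ i : Fin 2, ∑ j, ∑ k, ∑ l, invGram I r p i k * invGram I r p j l *
      metric I r p (S (b i)) (b j) * metric I r p (C (b k)) (b l) =
      ∑ k, invGram I r p k i * metric I r p (S (C (b k))) (b i) := by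
    intro i
    rw [Finset.sum_comm]
    refine Finset.sum_congr rfl fun k _ => ?_
    rw [metric_comm p (S _), ← h1, Finset.mul_sum, invGram_comm p i k]
    refine Finset.sum_congr rfl fun j _ => ?_
    rw [Finset.mul_sum]
    exact Finset.sum_congr rfl fun l _ => by ring
  rw [Finset.sum_congr rfl fun i _ => h2 i, Finset.sum_comm]
  exact Finset.sum_congr rfl fun k _ => (hrn.repr_tangentBasis p _ k).symm

theorem secondForm_eq (p : M) : secondForm I r n p = metric I r p ∘ₗ shape I r n p := by
  refine LinearMap.ext fun v => LinearMap.ext fun w => ?_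
  rw [LinearMap.comp_apply, metric_comm]
  exact (hrn.metric_sharp p _ w).symm

theorem ambientDiv_tangential {e : E3} (p : M) :
    ambientDiv I r (fun q => e - inner ℝ (n q) e • n q) p =
      tr (ambientShape I r n p) * inner ℝ (n p) e := by
  have hi : ContMDiff I 𝓘(ℝ, ℝ) ∞ (fun q => inner ℝ (n q) e) :=
    smooth_inner hrn.smooth_normal contMDiff_const
  rw [ambientDiv_sub contMDiff_const (smooth_smul hi hrn.smooth_normal), ambientDiv_const,
    ambientDiv_smul hi hrn.smooth_normal, hrn.tderiv_normal_direction, ambientDiv_normal]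
  ring

/-- By the Cayley-Hamilton theorem the tangential part of the stress tensor is of first order in
the shape operator. -/
theorem mvfderiv_stress (F : ℝ × ℝ → ℝ) (p : M) (e : E3) :
    mvfderiv I r p (stress I r n F p e) =
      (lagr I r n F p - gaussCurv I r n p * lagrK I r n F p) • (e - inner ℝ (n p) e • n p) -
        lagrH I r n F p • ambientShape I r n p e +
      inner ℝ (n p) e • (ambientShape I r n p (ambientGrad I r (lagrK I r n F) p) -
        ambientGrad I r (lagrH I r n F) p -
        meanCurv I r n p • ambientGrad I r (lagrK I r n F) p) := by
  have h : stress I r n F p e =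
      lagrK I r n F p • shape I r n p (shape I r n p (tangentialPart I r p e))
      - (lagrH I r n F p + meanCurv I r n p * lagrK I r n F p) •
          shape I r n p (tangentialPart I r p e)
      + inner ℝ (n p) e • (shape I r n p (grad I r (lagrK I r n F) p) - grad I r (lagrH I r n F) p
          - meanCurv I r n p • grad I r (lagrK I r n F) p)
      + lagr I r n F p • tangentialPart I r p e := rfl
  rw [h]
  simp only [map_add, map_sub, map_smul, ← hrn.ambientShape_mvfderiv]
  rw [hrn.ambientShape_mvfderiv p (tangentialPart I r p e), hrn.mvfderiv_shape_tangentialPart,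
    hrn.ambientShape_ambientShape, hrn.mvfderiv_tangentialPart, ← ambientGrad, ← ambientGrad]
  module

variable [IsManifold I ∞ M]

theorem metric_shape_comm (p : M) (v w : TangentSpace I p) :
    metric I r p (shape I r n p v) w = metric I r p v (shape I r n p w) := by
  rw [metric_apply, metric_apply, ← hrn.ambientShape_mvfderiv, ← hrn.ambientShape_mvfderiv,
    hrn.inner_ambientShape_comm]

theorem laplacian_eq {f : M → ℝ} (hf : ContMDiff I 𝓘(ℝ, ℝ) ∞ f) (p : M) :
    laplacian I r f p = ambientDiv I r (ambientGrad I r f) p :=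
  hrn.divergence_eq _ p (hrn.smooth_ambientGrad hf)

theorem formInner_secondForm (p : M) :
    formInner I r p (secondForm I r n p) (secondForm I r n p) =
      tr ((ambientShape I r n p).comp (ambientShape I r n p)) := by
  rw [hrn.secondForm_eq, hrn.formInner_metric_comp p _ _ (hrn.metric_shape_comm p),
    hrn.trace_shape_comp]

theorem formInner_secondForm_hess {f : M → ℝ} (hf : ContMDiff I 𝓘(ℝ, ℝ) ∞ f) (p : M) :
    formInner I r p (secondForm I r n p) (hess I r f p) =
      tr ((ambientShape I r n p).comp (tderiv I r (ambientGrad I r f) p)) := by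
  rw [hrn.secondForm_eq, hess, hrn.formInner_metric_comp p _ _ (hrn.metric_shape_comm p)]
  refine hrn.trace_eq_tr p _ _ fun e => ?_
  rw [LinearMap.comp_apply, hrn.covDeriv_eq _ p
    ((hrn.smooth_ambientGrad hf).mdifferentiable (by simp) p),
    hrn.mvfderiv_shape_tangentialPart]
  rfl

/-- Product rule, with the derivative falling on `A` evaluated by the contracted Codazzi equation.
It serves both for a constant field and for `∇F_K`. -/
theorem ambientDiv_ambientShape {V : M → E3} (hV : ContMDiff I 𝓘(ℝ, E3) ∞ V) (p : M) :
    ambientDiv I r (fun q => ambientShape I r n q (V q)) p =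
      tderiv I r (meanCurv I r n) p (V p) +
        inner ℝ (n p) (V p) * tr ((ambientShape I r n p).comp (ambientShape I r n p)) +
        tr ((ambientShape I r n p).comp (tderiv I r V p)) := by
  have h : tderiv I r (fun q => ambientShape I r n q (V q)) p =
      (tderiv I r (ambientShape I r n) p).flip (V p) +
        (ambientShape I r n p).comp (tderiv I r V p) :=
    ContinuousLinearMap.ext fun a => tderiv_clm_apply hrn.smooth_ambientShape hV p a
  rw [ambientDiv, h, map_add, hrn.tr_flip_tderiv_ambientShape]

end IsImmersionWithNormal

/-! ### The Lagrangian along the surface -/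

section Lagrangian

variable {U : Set (ℝ × ℝ)} {F : ℝ × ℝ → ℝ}

theorem deriv_fst_eq {a b : ℝ} (h : DifferentiableAt ℝ F (a, b)) :
    deriv (fun t => F (t, b)) a = fderiv ℝ F (a, b) (1, 0) := by
  have h1 : HasDerivAt (fun t : ℝ => (t, b)) ((1 : ℝ), (0 : ℝ)) a :=
    (hasDerivAt_id a).prodMk (hasDerivAt_const a b)
  exact (h.hasFDerivAt.comp_hasDerivAt a h1).deriv

theorem deriv_snd_eq {a b : ℝ} (h : DifferentiableAt ℝ F (a, b)) :
    deriv (fun t => F (a, t)) b = fderiv ℝ F (a, b) (0, 1) := by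
  have h1 : HasDerivAt (fun t : ℝ => (a, t)) ((0 : ℝ), (1 : ℝ)) b :=
    (hasDerivAt_const b a).prodMk (hasDerivAt_id b)
  exact (h.hasFDerivAt.comp_hasDerivAt b h1).deriv

theorem differentiableAt_lagrangian (hU : IsOpen U) (hF : ContDiffOn ℝ ∞ F U)
    (hHK : ∀ p : M, (meanCurv I r n p, gaussCurv I r n p) ∈ U) (p : M) :
    DifferentiableAt ℝ F (meanCurv I r n p, gaussCurv I r n p) :=
  (hF.contDiffAt (hU.mem_nhds (hHK p))).differentiableAt (by simp)

namespace IsImmersionWithNormal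

variable [IsManifold I ∞ M] (hrn : IsImmersionWithNormal I r n)
include hrn

theorem smooth_curvatures :
    ContMDiff I 𝓘(ℝ, ℝ × ℝ) ∞ (fun p => (meanCurv I r n p, gaussCurv I r n p)) :=
  hrn.smooth_meanCurv.prodMk_space hrn.smooth_gaussCurv

theorem smooth_comp_curvatures {E : Type*} [NormedAddCommGroup E] [NormedSpace ℝ E]
    {Φ : ℝ × ℝ → E} (hU : IsOpen U) (hΦ : ContDiffOn ℝ ∞ Φ U)
    (hHK : ∀ p : M, (meanCurv I r n p, gaussCurv I r n p) ∈ U) :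
    ContMDiff I 𝓘(ℝ, E) ∞ (fun p => Φ (meanCurv I r n p, gaussCurv I r n p)) := fun p =>
  ContDiffAt.comp_contMDiffAt (hΦ.contDiffAt (hU.mem_nhds (hHK p))) (hrn.smooth_curvatures p)

variable (hU : IsOpen U) (hF : ContDiffOn ℝ ∞ F U)
  (hHK : ∀ p : M, (meanCurv I r n p, gaussCurv I r n p) ∈ U)
include hU hF hHK

theorem smooth_lagr : ContMDiff I 𝓘(ℝ, ℝ) ∞ (lagr I r n F) :=
  hrn.smooth_comp_curvatures hU hF hHK

theorem smooth_lagrH : ContMDiff I 𝓘(ℝ, ℝ) ∞ (lagrH I r n F) := by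
  have h : lagrH I r n F =
      -- The total derivative is smooth on the open set `U`, hence so is its composition with the
      -- curvatures.
      fun p => fderiv ℝ F (meanCurv I r n p, gaussCurv I r n p) (1, 0) :=
    funext fun p => deriv_fst_eq (differentiableAt_lagrangian hU hF hHK p)
  rw [h]
  exact smooth_eval (hrn.smooth_comp_curvatures hU
    (hF.fderiv_of_isOpen hU (m := ∞) (by simp)) hHK) _

theorem smooth_lagrK : ContMDiff I 𝓘(ℝ, ℝ) ∞ (lagrK I r n F) := by
  have h : lagrK I r n F =
      fun p => fderiv ℝ F (meanCurv I r n p, gaussCurv I r n p) (0, 1) :=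
    funext fun p => deriv_snd_eq (differentiableAt_lagrangian hU hF hHK p)
  rw [h]
  exact smooth_eval (hrn.smooth_comp_curvatures hU
    (hF.fderiv_of_isOpen hU (m := ∞) (by simp)) hHK) _

theorem tderiv_lagr (p : M) (e : E3) :
    tderiv I r (lagr I r n F) p e = lagrH I r n F p * tderiv I r (meanCurv I r n) p e +
      lagrK I r n F p * tderiv I r (gaussCurv I r n) p e := by
  have hd := differentiableAt_lagrangian hU hF hHK p
  have h1 := tderiv_comp_fderiv (r := r) (g := F) hd hrn.smooth_curvatures e
  have h2 : tderiv I r (fun p => (meanCurv I r n p, gaussCurv I r n p)) p e =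
      (tderiv I r (meanCurv I r n) p e, tderiv I r (gaussCurv I r n) p e) :=
    Prod.ext
      (tderiv_clm (ContinuousLinearMap.fst ℝ ℝ ℝ) hrn.smooth_curvatures p e).symm
      (tderiv_clm (ContinuousLinearMap.snd ℝ ℝ ℝ) hrn.smooth_curvatures p e).symm
  have h3 (x y : ℝ) : ((x, y) : ℝ × ℝ) = x • (1, 0) + y • (0, 1) := by simp
  rw [h2, h3 (tderiv I r _ p e), map_add, map_smul, map_smul, ← deriv_fst_eq hd, ← deriv_snd_eq hd] at h1
  refine h1.trans ?_
  simp only [smul_eq_mul, lagrH, lagrK]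
  ring

/-! ### The divergence of the stress tensor -/

theorem divergence_stress (p : M) (e : E3) :
    divergence I r (fun q => stress I r n F q e) p =
      -(eulerLagrange I r n F p * inner ℝ (n p) e) := by
  have hFl := hrn.smooth_lagr hU hF hHK
  have hFH := hrn.smooth_lagrH hU hF hHK
  have hFK := hrn.smooth_lagrK hU hF hHK
  have hH := hrn.smooth_meanCurv
  have hK := hrn.smooth_gaussCurv
  have hn := hrn.smooth_normal
  have hS := hrn.smooth_ambientShape
  have hGH := hrn.smooth_ambientGrad hFH
  have hGK := hrn.smooth_ambientGrad hFK
  have hne : ContMDiff I 𝓘(ℝ, ℝ) ∞ (fun q => inner ℝ (n q) e) := smooth_inner hn contMDiff_const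
  have hPe : ContMDiff I 𝓘(ℝ, E3) ∞ (fun q => e - inner ℝ (n q) e • n q) :=
    contMDiff_const.sub (smooth_smul hne hn)
  have hSe : ContMDiff I 𝓘(ℝ, E3) ∞ (fun q => ambientShape I r n q e) := smooth_eval hS e
  have hSG := smooth_clm_apply hS hGK
  have hHG := smooth_smul hH hGK
  have hKF : ContMDiff I 𝓘(ℝ, ℝ) ∞ (fun q => gaussCurv I r n q * lagrK I r n F q) :=
    smooth_smul hK hFK
  have hc : ContMDiff I 𝓘(ℝ, ℝ) ∞
      (fun q => lagr I r n F q - gaussCurv I r n q * lagrK I r n F q) := hFl.sub hKF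
  have hZ : ContMDiff I 𝓘(ℝ, E3) ∞ (fun q =>
      ambientShape I r n q (ambientGrad I r (lagrK I r n F) q) -
        ambientGrad I r (lagrH I r n F) q -
        meanCurv I r n q • ambientGrad I r (lagrK I r n F) q) := (hSG.sub hGH).sub hHG
  have h1 := smooth_smul hc hPe
  have h2 := smooth_smul hFH hSe
  have h3 := smooth_smul hne hZ
  have hV : ContMDiff I 𝓘(ℝ, E3) ∞ (fun q => mvfderiv I r q (stress I r n F q e)) := by
    simp only [hrn.mvfderiv_stress]
    exact (h1.sub h2).add h3
  rw [hrn.divergence_eq _ p hV]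
  simp only [hrn.mvfderiv_stress]
  rw [ambientDiv_add (h1.sub h2) h3, ambientDiv_sub h1 h2, ambientDiv_smul hc hPe,
    ambientDiv_smul hFH hSe, ambientDiv_smul hne hZ, hrn.ambientDiv_tangential,
    hrn.ambientDiv_ambientShape contMDiff_const, ambientDiv_sub (hSG.sub hGH) hHG,
    ambientDiv_sub hSG hGH, ambientDiv_smul hH hGK, hrn.ambientDiv_ambientShape hGK,
    hrn.tderiv_tangential, tderiv_sub hFl hKF, tderiv_inner hn contMDiff_const, tderiv_const,
    hrn.tderiv_lagr hU hF hHK, ← hrn.meanCurv_eq]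
  have e1 : tderiv I r (fun _ : M => e) p = 0 :=
    ContinuousLinearMap.ext fun a => tderiv_const e p a
  have e2 : tderiv I r (fun q => gaussCurv I r n q * lagrK I r n F q) p e =
      tderiv I r (gaussCurv I r n) p e * lagrK I r n F p +
        gaussCurv I r n p * tderiv I r (lagrK I r n F) p e := tderiv_smul hK hFK p e
  -- Symmetry of `A` turns the derivative of `⟨n, e⟩` along `z` into a pairing of `z` with `A e`.
  have e3 (z : E3) : inner ℝ (tderiv I r n p z) e = -inner ℝ z (ambientShape I r n p e) := by
    rw [← hrn.inner_ambientShape_comm, ambientShape_apply, inner_neg_left, neg_neg]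
  have e4 : inner ℝ (n p) (ambientGrad I r (lagrK I r n F) p) = 0 := by
    rw [real_inner_comm, hrn.inner_ambientGrad, hrn.tderiv_normal_direction]
  -- Second use of Cayley-Hamilton: its `H` term cancels the `-H∇F_K` part of `Z`, its `K` term the
  -- derivative of `F_K` in `F - K F_K`.
  have e5 : tderiv I r (lagrK I r n F) p (ambientShape I r n p (ambientShape I r n p e)) =
      meanCurv I r n p * tderiv I r (lagrK I r n F) p (ambientShape I r n p e) -
        gaussCurv I r n p * tderiv I r (lagrK I r n F) p e := by
    rw [hrn.ambientShape_ambientShape, map_sub, map_smul, map_smul, hrn.tderiv_tangential,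
      smul_eq_mul, smul_eq_mul]
  rw [e1, e2, e3, e4, inner_sub_left, inner_sub_left, real_inner_smul_left,
    hrn.inner_ambientShape_comm, hrn.inner_ambientGrad, hrn.inner_ambientGrad,
    hrn.inner_ambientGrad, e5, eulerLagrange, hrn.laplacian_eq hFH, hrn.laplacian_eq hFK,
    hrn.formInner_secondForm, hrn.formInner_secondForm_hess hFK, ContinuousLinearMap.comp_zero,
    map_zero, inner_zero_right]
  -- In `div Z` the two terms `dH(∇F_K)`, from Codazzi and from differentiating `H∇F_K`, cancel as
  -- well.
  ring

theorem tensorDiv_stress (p : M) :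
    tensorDiv I r (stress I r n F) p = -(eulerLagrange I r n F p • n p) := by
  have h := (EuclideanSpace.basisFun (Fin 3) ℝ).sum_repr' (n p)
  conv_rhs => rw [← h]
  rw [tensorDiv, Finset.smul_sum, ← Finset.sum_neg_distrib]
  refine Finset.sum_congr rfl fun a _ => ?_
  rw [hrn.divergence_stress hU hF hHK, EuclideanSpace.basisFun_apply, real_inner_comm, smul_smul,
    neg_smul]

end IsImmersionWithNormal
end Lagrangian

end

end ImmersedSurface

end

theorem theorem3p3
    {H₀ : Type*} [TopologicalSpace H₀] (I : ModelWithCorners ℝ ImmersedSurface.E2 H₀)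
    {M : Type*} [TopologicalSpace M] [ChartedSpace H₀ M] [IsManifold I ∞ M]
    (r n : M → ImmersedSurface.E3) (hrn : ImmersedSurface.IsImmersionWithNormal I r n)
    (U : Set (ℝ × ℝ)) (hU : IsOpen U) (F : ℝ × ℝ → ℝ) (hF : ContDiffOn ℝ ∞ F U)
    (hHK : ∀ p : M,
      (ImmersedSurface.meanCurv I r n p, ImmersedSurface.gaussCurv I r n p) ∈ U) :
    (∀ p : M, ImmersedSurface.tensorDiv I r (ImmersedSurface.stress I r n F) p
        = -(ImmersedSurface.eulerLagrange I r n F p • n p)) ∧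
    (ImmersedSurface.IsWSurface I r n F ↔
      ∀ p : M, ImmersedSurface.tensorDiv I r (ImmersedSurface.stress I r n F) p = 0) := by
  have h := fun p => hrn.tensorDiv_stress hU hF hHK p
  refine ⟨h, fun hW p => ?_, fun hT p => ?_⟩
  · rw [h p, hW p, zero_smul, neg_zero]
  · have hn : n p ≠ 0 := fun h0 => by simpa [h0] using hrn.norm_normal p
    have h2 := hT p
    rw [h p, neg_eq_zero, smul_eq_zero] at h2
    exact h2.resolve_right hn
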